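/- Let $m\ge 1$ and let $H^m=\mathbb{R}^{2m+1}$ be the Heisenberg group, with points $q=(x_1,\dots,x_m,y_1,\dots,y_m,t)$, group law $(z,t)\circ(z',t')=\bigl(z+z',\,t+t'+2\sum_{i=1}^m(y_ix_i'-x_iy_i')\bigr)$ for $z=(x,y)$, $z'=(x',y')$, and left-invariant vector fields $$X_j=\frac{\partial}{\partial x_j}+2y_j\frac{\partial}{\partial t},\qquad Y_j=\frac{\partial}{\partial y_j}-2x_j\frac{\partial}{\partial t},\qquad j=1,\dots,m.$$ For a $C^1$ function $u$ write $\nabla_{H^m}u=(X_1u,\dots,X_mu,Y_1u,\dots,Y_mu)$, with the Euclidean product $\cdot$ and norm $|\cdot|_{H^m}$ on $\mathbb{R}^{2m}$. Let $\varphi:[0,\infty)\to\mathbb{R}$ satisfy * $\varphi\in C^0([0,\infty))\cap C^1((0,\infty))$, $\varphi(0)=0$, and $\varphi'>0$ on $(0,\infty)$; * there are constants $D>0$ and $\tau\ge 0$ such that $s\,\varphi'(st)\le D\,s^{\tau}\varphi'(t)$ for all $s\in(0,1]$ and $t>0$. Let $\Omega\subset H^m$ be a domain (a non-empty connected open set,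 not necessarily bounded), and let $u\in C^0(\overline\Omega)\cap C^1(\Omega)$ satisfy $\Delta^\varphi_{H^m}u\ge 0$ in $\Omega$ in the weak sense, that is, $$-\int_\Omega |\nabla_{H^m}u|_{H^m}^{-1}\,\varphi\bigl(|\nabla_{H^m}u|_{H^m}\bigr)\,\nabla_{H^m}u\cdot\nabla_{H^m}\zeta\ \ge\ 0\qquad\text{for all }\zeta\in C_c^\infty(\Omega),\ \zeta\ge 0$$ (integration with respect to Lebesgue measure; the vector $|\nabla_{H^m}u|_{H^m}^{-1}\varphi(|\nabla_{H^m}u|_{H^m})\nabla_{H^m}u$ is taken to be $0$ where $\nabla_{H^m}u=0$). Let $u^*=\sup_\Omega u$. If $u(q_M)=u^*$ for some $q_M\in\Omega$, then $u\equiv u^*$ on $\overline\Omega$. -/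

import Mathlib

open scoped ContDiff

/-- The Heisenberg group `H^m`: the underlying manifold is `ℝ^(2m+1)`, with points
`q = (x, y, t)`.  (The product carries a sup norm, but only its topology, its smooth structure
and its Lebesgue measure `volume` are used.) -/
abbrev Heis (m : ℕ) : Type := (Fin m → ℝ) × (Fin m → ℝ) × ℝ

/-- The group law of the Heisenberg group. -/
def heisMul {m : ℕ} (q q' : Heis m) : Heis m :=
  (q.1 + q'.1, q.2.1 + q'.2.1,
    q.2.2 + q'.2.2 + 2 * ∑ i, (q.2.1 i * q'.1 i - q.1 i * q'.2.1 i))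

/-- The vector field `X_j = ∂/∂x_j + 2 y_j ∂/∂t`. -/
def heisX {m : ℕ} (j : Fin m) (q : Heis m) : Heis m := (Pi.single j 1, 0, 2 * q.2.1 j)

/-- The vector field `Y_j = ∂/∂y_j - 2 x_j ∂/∂t`. -/
def heisY {m : ℕ} (j : Fin m) (q : Heis m) : Heis m := (0, Pi.single j 1, -2 * q.1 j)

/-- `X_j` is the left-invariant vector field with value `∂/∂x_j` at the origin. -/
theorem heisMul_eq_add_heisX {m : ℕ} (j : Fin m) (q : Heis m) (s : ℝ) :
    heisMul q (s • (Pi.single j 1, 0, 0)) = q + s • heisX j q := by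
  refine Prod.ext ?_ (Prod.ext ?_ ?_) <;> simp [heisMul, heisX, Pi.single_apply]
  ring

/-- `Y_j` is the left-invariant vector field with value `∂/∂y_j` at the origin. -/
theorem heisMul_eq_add_heisY {m : ℕ} (j : Fin m) (q : Heis m) (s : ℝ) :
    heisMul q (s • (0, Pi.single j 1, 0)) = q + s • heisY j q := by
  refine Prod.ext ?_ (Prod.ext ?_ ?_) <;> simp [heisMul, heisY, Pi.single_apply]
  ring

/-- The Heisenberg gradient of `u` at `q`, as the vector of its components
`(X_1 u, …, X_m u, Y_1 u, …, Y_m u)` in the frame `X_1, …, X_m, Y_1, …, Y_m`, which is orthonormal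
for the product on the horizontal bundle. -/
noncomputable def heisGrad {m : ℕ} (u : Heis m → ℝ) (q : Heis m) :
    EuclideanSpace ℝ (Fin m ⊕ Fin m) :=
  WithLp.toLp 2
    (Sum.elim (fun j => fderiv ℝ u q (heisX j q)) (fun j => fderiv ℝ u q (heisY j q)))

/-- The flux `|∇_H u|⁻¹ φ(|∇_H u|) ∇_H u` of the `φ`-Laplacian; it is `0` where `∇_H u = 0`, which
is its continuous extension because `φ(0) = 0`. -/
noncomputable def heisFlux {m : ℕ} (φ : ℝ → ℝ) (u : Heis m → ℝ) (q : Heis m) :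
    EuclideanSpace ℝ (Fin m ⊕ Fin m) :=
  (‖heisGrad u q‖⁻¹ * φ ‖heisGrad u q‖) • heisGrad u q

/-- `Δ^φ_{H^m} u ≥ 0` in `Ω` in the weak sense, for `u` of class `C¹` on the open set `Ω`:
`-∫_Ω |∇_H u|⁻¹ φ(|∇_H u|) ∇_H u · ∇_H ζ ≥ 0` for all `0 ≤ ζ ∈ C_c^∞(Ω)`. -/
def PhiLaplacianNonneg {m : ℕ} (φ : ℝ → ℝ) (Ω : Set (Heis m)) (u : Heis m → ℝ) : Prop :=
  ∀ ζ : Heis m → ℝ, ContDiff ℝ ∞ ζ → HasCompactSupport ζ → tsupport ζ ⊆ Ω → (∀ q, 0 ≤ ζ q) →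
    0 ≤ -∫ q in Ω, inner ℝ (heisFlux φ u q) (heisGrad ζ q)

/-- The structural conditions on `φ`, regarded as a function on `[0, ∞)`. -/
structure PhiStructural (φ : ℝ → ℝ) : Prop where
  continuousOn : ContinuousOn φ (Set.Ici 0)
  contDiffOn : ContDiffOn ℝ 1 φ (Set.Ioi 0)
  map_zero : φ 0 = 0
  deriv_pos : ∀ t : ℝ, 0 < t → 0 < deriv φ t

/-- The relaxed homogeneity condition on `φ'`: `s φ'(s t) ≤ D s^τ φ'(t)` for some constants `D > 0`
and `τ ≥ 0`, for all `s ∈ (0, 1]` and `t > 0`. -/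
def PhiRelaxedHomogeneous (φ : ℝ → ℝ) : Prop :=
  ∃ D τ : ℝ, 0 < D ∧ 0 ≤ τ ∧
    ∀ s t : ℝ, 0 < s → s ≤ 1 → 0 < t → s * deriv φ (s * t) ≤ D * s ^ τ * deriv φ t

/-!
Let `F` be the contact set `{u = u*}`. Suppose that some `w` has a local maximum along `F` at
`q₀ ∈ F` and a nonzero horizontal gradient there. After making that maximum strict and
normalizing `w q₀ = 0`, the function `u* - η ∘ w` is a barrier above `u` on small spheres, and the
comparison principle makes `u + η ∘ w` maximal at `q₀`, which is absurd, provided `η ∘ w` is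
strictly `φ`-subharmonic; this holds as soon as `η` solves
`η'' = M (η' + φ(η') / φ'(η'))`. The relaxed homogeneity of `φ'` makes `φ / φ'` almost monotone
and linearly small, which provides solutions with arbitrarily small positive `η'`.

So every such `w` has zero horizontal gradient, and `F` is invariant under the flows of the
horizontal left-invariant fields. Commutators of these flows move points vertically, by an amount
quadratic in time; hence `F` is open in `Ω`, and connectedness concludes.
-/

open Filter Topology Set MeasureTheory

section AlmostMonotone

/-- `p` is almost monotone with constant `D`: it is monotone up to the factor `D`. For
`p x = eˣ φ'(eˣ)` this is what the relaxed homogeneity of `φ'` amounts to. -/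
def AlmostMonotone (D : ℝ) (p : ℝ → ℝ) : Prop :=
  ∀ ⦃x y : ℝ⦄, x ≤ y → p x ≤ D * p y

variable {D : ℝ} {f p : ℝ → ℝ}

theorem AlmostMonotone.one_le (hp : AlmostMonotone D p) {x : ℝ} (hx : 0 < p x) : 1 ≤ D :=
  le_of_mul_le_mul_right (by simpa using hp le_rfl) hx

theorem AlmostMonotone.image_sub_le (hp : AlmostMonotone D p) (hf : ∀ x, HasDerivAt f (p x) x)
    {x y : ℝ} (hyx : y ≤ x) : f x - f y ≤ D * p x * (x - y) := by
  refine Convex.image_sub_le_mul_sub_of_deriv_le (convex_Iic x)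
    (fun z _ => (hf z).continuousAt.continuousWithinAt)
    (fun z _ => (hf z).differentiableAt.differentiableWithinAt) (fun z hz => ?_)
    y hyx x self_mem_Iic hyx
  rw [(hf z).deriv]
  exact hp (interior_subset hz : z ∈ Iic x)

theorem AlmostMonotone.le_mul_add_div (hp : AlmostMonotone D p) (hf : ∀ x, HasDerivAt f (p x) x)
    (hf0 : ∀ x, 0 ≤ f x) (hp0 : ∀ x, 0 < p x) {x y : ℝ} (hyx : y ≤ x) :
    f x ≤ D * p x * (x - y + f y / p y) := by
  have hfy : f y ≤ D * p x * (f y / p y) :=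
    calc f y = p y * (f y / p y) := by have := hp0 y; field_simp
      _ ≤ D * p x * (f y / p y) :=
        mul_le_mul_of_nonneg_right (hp hyx) (div_nonneg (hf0 y) (hp0 y).le)
  linarith [hp.image_sub_le hf hyx]

theorem AlmostMonotone.one_add_div_le (hp : AlmostMonotone D p)
    (hf : ∀ x, HasDerivAt f (p x) x) (hf0 : ∀ x, 0 ≤ f x) (hp0 : ∀ x, 0 < p x) {x y : ℝ}
    (hyx : y ≤ x) (hxy : x ≤ y + 1) : 1 + f x / p x ≤ (1 + D) * (1 + f y / p y) := by
  have hD : 1 ≤ D := hp.one_le (hp0 x)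
  have hx : f x / p x ≤ D * (x - y + f y / p y) := by
    rw [div_le_iff₀ (hp0 x)]
    linarith [hp.le_mul_add_div hf hf0 hp0 hyx]
  have hstep : D * (x - y) ≤ D := by nlinarith
  have hy : 0 ≤ f y / p y := div_nonneg (hf0 y) (hp0 y).le
  linarith

theorem tendsto_deriv_zero_of_tendsto_atBot {Ψ κ : ℝ → ℝ} {C l : ℝ}
    (hΨ : ∀ x, HasDerivAt Ψ (κ x) x) (hκ0 : ∀ x, 0 ≤ κ x)
    (hκ : ∀ x y, y ≤ x → x ≤ y + 1 → κ y ≤ C * κ x) (hl : Tendsto Ψ atBot (𝓝 l)) :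
    Tendsto κ atBot (𝓝 0) := by
  have hinc : Tendsto (fun y => C * (Ψ (y + 1) - Ψ y)) atBot (𝓝 0) := by
    simpa using ((hl.comp (tendsto_atBot_add_const_right _ 1 tendsto_id)).sub hl).const_mul C
  refine squeeze_zero hκ0 (fun y => ?_) hinc
  obtain ⟨z, hz, hslope⟩ := exists_hasDerivAt_eq_slope Ψ κ (lt_add_one y)
    (fun x _ => (hΨ x).continuousAt.continuousWithinAt) fun x _ => hΨ x
  simpa [hslope] using hκ z y hz.1.le hz.2.le

theorem tendsto_atBot_of_deriv_le_mul {f p Ψ κ : ℝ → ℝ} {C : ℝ} (hC : 0 < C)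
    (hf : ∀ x, HasDerivAt f (p x) x) (hf0 : ∀ x, 0 < f x) (hlim : Tendsto f atBot (𝓝 0))
    (hΨ : ∀ x, HasDerivAt Ψ (κ x) x) (hle : ∀ᶠ x in atBot, p x ≤ C * κ x * f x) :
    Tendsto Ψ atBot atBot := by
  obtain ⟨x₀, hx₀⟩ := eventually_atBot.1 hle
  have hderiv (x : ℝ) : HasDerivAt (fun x => Real.log (f x) - C * Ψ x) (p x / f x - C * κ x) x :=
    ((hf x).log (hf0 x).ne').sub ((hΨ x).const_mul C)
  have hanti : AntitoneOn (fun x => Real.log (f x) - C * Ψ x) (Iic x₀) := by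
    refine antitoneOn_of_deriv_nonpos (convex_Iic x₀)
      (fun x _ => (hderiv x).continuousAt.continuousWithinAt)
      (fun x _ => (hderiv x).differentiableAt.differentiableWithinAt) fun x hx => ?_
    rw [(hderiv x).deriv, sub_nonpos, div_le_iff₀ (hf0 x)]
    exact hx₀ x (interior_subset hx : x ∈ Iic x₀)
  have hlog : Tendsto (fun x => Real.log (f x)) atBot atBot :=
    Real.tendsto_log_nhdsGT_zero.comp
      (tendsto_nhdsWithin_iff.2 ⟨hlim, Eventually.of_forall hf0⟩)
  refine tendsto_atBot_mono' _ ?_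
    (((tendsto_atBot_add_const_right _ (C * Ψ x₀ - Real.log (f x₀)) hlog)).atBot_div_const hC)
  filter_upwards [eventually_le_atBot x₀] with x hx
  have := hanti hx self_mem_Iic hx
  rw [le_div_iff₀ hC]
  linarith

theorem hasDerivAt_integral_of_continuous {g : ℝ → ℝ} (hg : Continuous g) (a x : ℝ) :
    HasDerivAt (fun x => ∫ s in a..x, g s) (g x) x :=
  intervalIntegral.integral_hasDerivAt_right (hg.intervalIntegrable _ _)
    (hg.stronglyMeasurableAtFilter _ _) hg.continuousAt

/-- An Osgood condition: the time `∫ (1 + f / f')⁻¹` that a solution of `X' = 1 + f(X) / f'(X)`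
needs to come back from `-∞` is infinite. -/
theorem AlmostMonotone.tendsto_integral_inv_one_add_div (hp : AlmostMonotone D p)
    (hf : ∀ x, HasDerivAt f (p x) x) (hf0 : ∀ x, 0 < f x) (hp0 : ∀ x, 0 < p x)
    (hpc : Continuous p) (hlim : Tendsto f atBot (𝓝 0)) (a : ℝ) :
    Tendsto (fun x => ∫ s in a..x, (1 + f s / p s)⁻¹) atBot atBot := by
  have hfc : Continuous f := continuous_iff_continuousAt.2 fun x => (hf x).continuousAt
  have hpos (x : ℝ) : 0 < 1 + f x / p x := add_pos one_pos (div_pos (hf0 x) (hp0 x))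
  have hcont : Continuous fun x => (1 + f x / p x)⁻¹ :=
    (continuous_const.add (hfc.div hpc fun x => (hp0 x).ne')).inv₀ fun x => (hpos x).ne'
  have hderiv := hasDerivAt_integral_of_continuous hcont a
  have hmono := (strictMono_of_hasDerivAt_pos hderiv fun x => inv_pos.2 (hpos x)).monotone
  rcases tendsto_atBot_of_monotone hmono with h | ⟨l, hl⟩
  · exact h
  have hκ : Tendsto (fun x => (1 + f x / p x)⁻¹) atBot (𝓝 0) := by
    refine tendsto_deriv_zero_of_tendsto_atBot (C := 1 + D) hderiv
      (fun x => (inv_pos.2 (hpos x)).le) (fun x y hyx hxy => ?_) hl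
    have := hp.one_add_div_le hf (fun x => (hf0 x).le) hp0 hyx hxy
    rwa [← div_eq_mul_inv, inv_eq_one_div, div_le_div_iff₀ (hpos y) (hpos x), one_mul]
  refine tendsto_atBot_of_deriv_le_mul two_pos hf hf0 hlim hderiv ?_
  filter_upwards [hκ.eventually_le_const one_half_pos] with x hx
  have hfp : p x ≤ f x := by
    rw [inv_le_comm₀ (hpos x) one_half_pos, one_div, inv_inv] at hx
    have : 1 ≤ f x / p x := by linarith
    rwa [one_le_div (hp0 x)] at this
  have := hp0 x
  have hκ_eq : (1 + f x / p x)⁻¹ = p x / (p x + f x) := by field_simp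
  rw [hκ_eq, mul_assoc, div_mul_eq_mul_div, ← mul_div_assoc, le_div_iff₀ (by linarith [hf0 x])]
  nlinarith

theorem exists_monotone_hasDerivAt_of_tendsto_integral_inv {r : ℝ → ℝ} (hr : Continuous r)
    (hr0 : ∀ x, 0 < r x) {a : ℝ} (hbot : Tendsto (fun x => ∫ s in a..x, (r s)⁻¹) atBot atBot)
    (htop : Tendsto (fun x => ∫ s in a..x, (r s)⁻¹) atTop atTop) :
    ∃ X : ℝ → ℝ, Monotone X ∧ X 0 = a ∧ ∀ y, HasDerivAt X (r (X y)) y := by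
  have hderiv := hasDerivAt_integral_of_continuous (hr.inv₀ fun x => (hr0 x).ne') a
  have hcont := continuous_iff_continuousAt.2 fun x => (hderiv x).continuousAt
  have hmono := strictMono_of_hasDerivAt_pos hderiv fun x => inv_pos.2 (hr0 x)
  let e : ℝ ≃o ℝ := hmono.orderIsoOfSurjective _ (hcont.surjective htop hbot)
  refine ⟨e.symm, e.symm.monotone, ?_, fun y => ?_⟩
  · rw [e.symm_apply_eq]
    exact intervalIntegral.integral_same.symm
  · simpa using (hderiv (e.symm y)).of_local_left_inverse e.symm.continuous.continuousAt
      (inv_pos.2 (hr0 _)).ne' (Eventually.of_forall e.apply_symm_apply)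

theorem exists_contDiff_deriv_eq_mul {r : ℝ → ℝ} (hr : Continuous r) (hr0 : ∀ x, 0 < r x) {a : ℝ}
    (hosgood : Tendsto (fun x => ∫ s in a..x, (r s)⁻¹) atBot atBot) {M : ℝ} (hM : 0 ≤ M) (b : ℝ) :
    ∃ X : ℝ → ℝ, ContDiff ℝ 1 X ∧ ∀ y ≤ b, X y ≤ a ∧ deriv X y = M * r (X y) := by
  -- Freezing the right-hand side above `a` makes the solutions global in both time directions.
  have hgc : Continuous fun s => r (min s a) := by fun_prop
  have hbot : Tendsto (fun x => ∫ s in a..x, (r (min s a))⁻¹) atBot atBot := by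
    refine hosgood.congr' ?_
    filter_upwards [eventually_le_atBot a] with x hx
    refine intervalIntegral.integral_congr fun s hs => ?_
    rw [uIcc_of_ge hx] at hs
    simp only [min_eq_left hs.2]
  have htop : Tendsto (fun x => ∫ s in a..x, (r (min s a))⁻¹) atTop atTop := by
    refine ((tendsto_atTop_add_const_right _ (-a) tendsto_id).atTop_mul_const
      (inv_pos.2 (hr0 a))).congr' ?_
    filter_upwards [eventually_ge_atTop a] with x hx
    have hconst : ∫ s in a..x, (r (min s a))⁻¹ = ∫ _ in a..x, (r a)⁻¹ := by
      refine intervalIntegral.integral_congr fun s hs => ?_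
      rw [uIcc_of_le hx] at hs
      simp only [min_eq_right hs.1]
    rw [hconst, intervalIntegral.integral_const, smul_eq_mul, id, sub_eq_add_neg]
  obtain ⟨X, hmono, hX0, hX⟩ := exists_monotone_hasDerivAt_of_tendsto_integral_inv hgc
    (fun s => hr0 _) hbot htop
  have hXM (y : ℝ) : HasDerivAt (fun y => X (M * (y - b)))
      (M * r (min (X (M * (y - b))) a)) y := by
    have := (hX (M * (y - b))).comp y (((hasDerivAt_id y).sub_const b).const_mul M)
    rwa [mul_one, mul_comm] at this
  have hXc : Continuous X := continuous_iff_continuousAt.2 fun y => (hX y).continuousAt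
  refine ⟨fun y => X (M * (y - b)), contDiff_one_iff_deriv.2
    ⟨fun y => (hXM y).differentiableAt, ?_⟩, fun y hy => ?_⟩
  · rw [funext fun y => (hXM y).deriv]
    fun_prop
  · have hle : X (M * (y - b)) ≤ a :=
      hX0 ▸ hmono (mul_nonpos_of_nonneg_of_nonpos hM (sub_nonpos.2 hy))
    exact ⟨hle, by rw [(hXM y).deriv, min_eq_left hle]⟩

end AlmostMonotone

section Structural

variable {φ : ℝ → ℝ}

theorem PhiStructural.hasDerivAt (hφ : PhiStructural φ) {t : ℝ} (ht : 0 < t) :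
    HasDerivAt φ (deriv φ t) t :=
  ((hφ.contDiffOn.contDiffAt (Ioi_mem_nhds ht)).differentiableAt one_ne_zero).hasDerivAt

theorem PhiStructural.continuousOn_deriv (hφ : PhiStructural φ) :
    ContinuousOn (deriv φ) (Ioi 0) :=
  hφ.contDiffOn.continuousOn_deriv_of_isOpen isOpen_Ioi le_rfl

theorem PhiStructural.strictMonoOn (hφ : PhiStructural φ) : StrictMonoOn φ (Ici 0) := by
  refine strictMonoOn_of_deriv_pos (convex_Ici 0) hφ.continuousOn fun x hx => ?_
  rw [interior_Ici] at hx
  exact hφ.deriv_pos x hx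

theorem PhiStructural.pos (hφ : PhiStructural φ) {t : ℝ} (ht : 0 < t) : 0 < φ t :=
  hφ.map_zero ▸ hφ.strictMonoOn self_mem_Ici ht.le ht

theorem PhiStructural.hasDerivAt_comp_exp (hφ : PhiStructural φ) (x : ℝ) :
    HasDerivAt (fun x => φ (Real.exp x)) (Real.exp x * deriv φ (Real.exp x)) x := by
  rw [mul_comm]
  exact (hφ.hasDerivAt (Real.exp_pos x)).comp x (Real.hasDerivAt_exp x)

theorem PhiStructural.exp_mul_deriv_pos (hφ : PhiStructural φ) (x : ℝ) :
    0 < Real.exp x * deriv φ (Real.exp x) :=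
  mul_pos (Real.exp_pos x) (hφ.deriv_pos _ (Real.exp_pos x))

theorem PhiStructural.continuous_exp_mul_deriv (hφ : PhiStructural φ) :
    Continuous fun x => Real.exp x * deriv φ (Real.exp x) :=
  Real.continuous_exp.mul
    (hφ.continuousOn_deriv.comp_continuous Real.continuous_exp Real.exp_pos)

theorem PhiStructural.tendsto_comp_exp_atBot (hφ : PhiStructural φ) :
    Tendsto (fun x => φ (Real.exp x)) atBot (𝓝 0) := by
  have hcont : Tendsto φ (𝓝[Ici 0] 0) (𝓝 0) := by
    simpa [hφ.map_zero] using (hφ.continuousOn 0 self_mem_Ici).tendsto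
  exact hcont.comp (tendsto_nhdsWithin_iff.2
    ⟨Real.tendsto_exp_atBot, Eventually.of_forall fun x => (Real.exp_pos x).le⟩)

theorem PhiRelaxedHomogeneous.exists_almostMonotone (hφ : PhiStructural φ)
    (hφ2 : PhiRelaxedHomogeneous φ) :
    ∃ D, AlmostMonotone D fun x => Real.exp x * deriv φ (Real.exp x) := by
  obtain ⟨D, τ, hD, hτ, h⟩ := hφ2
  refine ⟨D, fun x y hxy => ?_⟩
  have hs : Real.exp (x - y) ≤ 1 := Real.exp_le_one_iff.2 (sub_nonpos.2 hxy)
  have hscale : Real.exp (x - y) * Real.exp y = Real.exp x := by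
    rw [← Real.exp_add, sub_add_cancel]
  have hderiv : 0 < deriv φ (Real.exp y) := hφ.deriv_pos _ (Real.exp_pos y)
  calc Real.exp x * deriv φ (Real.exp x)
      = Real.exp y * (Real.exp (x - y) * deriv φ (Real.exp (x - y) * Real.exp y)) := by
        rw [hscale, ← mul_assoc, mul_comm (Real.exp y), hscale]
    _ ≤ Real.exp y * (D * Real.exp (x - y) ^ τ * deriv φ (Real.exp y)) := by
        exact mul_le_mul_of_nonneg_left (h _ _ (Real.exp_pos _) hs (Real.exp_pos y))
          (Real.exp_pos y).le
    _ ≤ Real.exp y * (D * 1 * deriv φ (Real.exp y)) := by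
        gcongr
        exact Real.rpow_le_one (Real.exp_pos _).le hs hτ
    _ = D * (Real.exp y * deriv φ (Real.exp y)) := by ring

theorem PhiStructural.le_mul_deriv_mul (hφ : PhiStructural φ) {D : ℝ}
    (hD : AlmostMonotone D fun x => Real.exp x * deriv φ (Real.exp x)) {A s t : ℝ} (hs : 0 < s)
    (hst : s ≤ t) (hts : t ≤ A * s) :
    φ t ≤ D * A ^ 2 * deriv φ t * (s + φ s / deriv φ s) := by
  have ht : 0 < t := hs.trans_le hst
  have hA : 1 ≤ A := le_of_mul_le_mul_right (by linarith) hs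
  have hφt := hφ.deriv_pos t ht
  have hφs := hφ.deriv_pos s hs
  have hφs0 := hφ.pos hs
  have hD0 : 0 < D := one_pos.trans_le (hD.one_le (hφ.exp_mul_deriv_pos 0))
  have hlog : Real.log t - Real.log s ≤ A := by
    rw [← Real.log_div ht.ne' hs.ne']
    linarith [Real.log_le_sub_one_of_pos (div_pos ht hs), (div_le_iff₀ hs).2 hts]
  have hgrowth := hD.le_mul_add_div hφ.hasDerivAt_comp_exp
    (fun x => (hφ.pos (Real.exp_pos x)).le) hφ.exp_mul_deriv_pos (Real.log_le_log hs hst)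
  rw [Real.exp_log ht, Real.exp_log hs] at hgrowth
  calc φ t ≤ D * (t * deriv φ t) * (Real.log t - Real.log s + φ s / (s * deriv φ s)) := hgrowth
    _ ≤ D * (A * s * deriv φ t) * (A + A * (φ s / (s * deriv φ s))) := by
        gcongr
        · exact add_nonneg (sub_nonneg.2 (Real.log_le_log hs hst)) (by positivity)
        · exact le_mul_of_one_le_left (by positivity) hA
    _ = D * A ^ 2 * deriv φ t * (s + φ s / deriv φ s) := by field_simp

theorem PhiStructural.exists_slope (hφ : PhiStructural φ) {D : ℝ}
    (hD : AlmostMonotone D fun x => Real.exp x * deriv φ (Real.exp x)) {M ε : ℝ} (hM : 0 ≤ M)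
    (hε : 0 < ε) (b : ℝ) :
    ∃ θ : ℝ → ℝ, ContDiff ℝ 1 θ ∧ (∀ y, 0 < θ y) ∧ (∀ y ≤ b, θ y ≤ ε) ∧
      ∀ y ≤ b, deriv θ y = M * (θ y + φ (θ y) / deriv φ (θ y)) := by
  have hosgood := hD.tendsto_integral_inv_one_add_div hφ.hasDerivAt_comp_exp
    (fun x => hφ.pos (Real.exp_pos x)) hφ.exp_mul_deriv_pos hφ.continuous_exp_mul_deriv
    hφ.tendsto_comp_exp_atBot (Real.log ε)
  have hfc : Continuous fun x => φ (Real.exp x) :=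
    continuous_iff_continuousAt.2 fun x => (hφ.hasDerivAt_comp_exp x).continuousAt
  have hrc : Continuous fun x => 1 + φ (Real.exp x) / (Real.exp x * deriv φ (Real.exp x)) :=
    continuous_const.add (hfc.div hφ.continuous_exp_mul_deriv
      fun x => (hφ.exp_mul_deriv_pos x).ne')
  obtain ⟨X, hX, hXb⟩ := exists_contDiff_deriv_eq_mul hrc
    (fun x => add_pos one_pos (div_pos (hφ.pos (Real.exp_pos x)) (hφ.exp_mul_deriv_pos x)))
    hosgood hM b
  refine ⟨fun y => Real.exp (X y), hX.exp, fun y => Real.exp_pos _,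
    fun y hy => (Real.le_log_iff_exp_le hε).1 (hXb y hy).1, fun y hy => ?_⟩
  have := hφ.deriv_pos _ (Real.exp_pos (X y))
  rw [(hX.differentiable one_ne_zero y).hasDerivAt.exp.deriv, (hXb y hy).2]
  field_simp

theorem PhiStructural.exists_profile (hφ : PhiStructural φ) {D : ℝ}
    (hD : AlmostMonotone D fun x => Real.exp x * deriv φ (Real.exp x)) {M δ b : ℝ} (hM : 0 ≤ M)
    (hδ : 0 < δ) (hb : 0 < b) :
    ∃ η : ℝ → ℝ, ContDiff ℝ 2 η ∧ η 0 = 0 ∧ (∀ y, 0 < deriv η y) ∧ (∀ y ≤ b, η y ≤ δ) ∧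
      ∀ y ≤ b, deriv (deriv η) y =
        M * (deriv η y + φ (deriv η y) / deriv φ (deriv η y)) := by
  obtain ⟨θ, hθ, hθ0, hθb, hθ'⟩ := hφ.exists_slope hD hM (div_pos hδ hb) b
  have hderiv := hasDerivAt_integral_of_continuous hθ.continuous 0
  have hdη : deriv (fun y => ∫ s in (0 : ℝ)..y, θ s) = θ := funext fun y => (hderiv y).deriv
  have hmono := (strictMono_of_hasDerivAt_pos hderiv hθ0).monotone
  have hηb : ∫ s in (0 : ℝ)..b, θ s ≤ δ :=
    calc ∫ s in (0 : ℝ)..b, θ s ≤ ∫ _ in (0 : ℝ)..b, δ / b :=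
          intervalIntegral.integral_mono_on hb.le (hθ.continuous.intervalIntegrable 0 b)
            (continuous_const.intervalIntegrable 0 b) fun y hy => hθb y hy.2
      _ = δ := by
        rw [intervalIntegral.integral_const, smul_eq_mul, sub_zero, mul_div_cancel₀ _ hb.ne']
  refine ⟨_, ?_, intervalIntegral.integral_same, fun y => ?_, fun y hy => (hmono hy).trans hηb,
    by rwa [hdη]⟩
  · rw [← one_add_one_eq_two, contDiff_succ_iff_deriv, hdη]
    exact ⟨fun y => (hderiv y).differentiableAt, by simp, hθ⟩
  · rw [hdη]
    exact hθ0 y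

end Structural

section Mollification

variable {E : Type*} [NormedAddCommGroup E] [NormedSpace ℝ E]

open scoped Convolution Pointwise in
theorem exists_contDiff_abs_fderiv_sub_le [FiniteDimensional ℝ E] {ζ : E → ℝ} (hζ : ContDiff ℝ 1 ζ)
    (hζc : HasCompactSupport ζ) (hζ0 : ∀ q, 0 ≤ ζ q) {δ ε : ℝ} (hδ : 0 < δ) (hε : 0 < ε) :
    ∃ ζ' : E → ℝ, ContDiff ℝ ∞ ζ' ∧ tsupport ζ' ⊆ Metric.cthickening δ (tsupport ζ) ∧
      (∀ q, 0 ≤ ζ' q) ∧ ∀ q v, |fderiv ℝ ζ' q v - fderiv ℝ ζ q v| ≤ ε * ‖v‖ := by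
  borelize E
  let μ : Measure E := Measure.addHaar
  have hζ' : Continuous (fderiv ℝ ζ) := hζ.continuous_fderiv one_ne_zero
  obtain ⟨r, hr, hunif⟩ := Metric.uniformContinuous_iff.1
    ((hζc.fderiv ℝ).uniformContinuous_of_continuous hζ') ε hε
  let b : ContDiffBump (0 : E) :=
    ⟨min δ r / 2, min δ r, by positivity, half_lt_self (by positivity)⟩
  have hb : LocallyIntegrable (b.normed μ) μ := b.continuous_normed.locallyIntegrable
  refine ⟨b.normed μ ⋆[ContinuousLinearMap.lsmul ℝ ℝ, μ] ζ,
    b.hasCompactSupport_normed.contDiff_convolution_left _ b.contDiff_normed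
      hζ.continuous.locallyIntegrable,
    closure_minimal ((support_convolution_subset _).trans ?_) Metric.isClosed_cthickening,
    fun q => integral_nonneg fun t => mul_nonneg (b.nonneg_normed t) (hζ0 _), fun q v => ?_⟩
  · rintro _ ⟨x, hx, y, hy, rfl⟩
    rw [b.support_normed_eq, mem_ball_zero_iff] at hx
    refine Metric.mem_cthickening_of_dist_le _ y _ _ (subset_tsupport _ hy) ?_
    simpa using hx.le.trans (min_le_left _ _)
  · rw [(hζc.hasFDerivAt_convolution_right _ hb hζ q).fderiv,
      convolution_precompR_apply _ hb (hζc.fderiv ℝ) hζ', ← Real.dist_eq]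
    refine b.dist_normed_convolution_le (by fun_prop) fun x hx => ?_
    have hxq : ‖fderiv ℝ ζ x - fderiv ℝ ζ q‖ ≤ ε :=
      dist_eq_norm (fderiv ℝ ζ x) _ ▸ (hunif (hx.trans_le (min_le_right _ _))).le
    rw [Real.dist_eq, ← sub_apply, ← Real.norm_eq_abs]
    exact ContinuousLinearMap.le_of_opNorm_le _ hxq v

variable [MeasurableSpace E] {μ : Measure E}

theorem setIntegral_fderiv_eq_integral {f : E → ℝ} {s : Set E} (hf : tsupport f ⊆ s)
    (W : E → E) : ∫ q in s, fderiv ℝ f q (W q) ∂μ = ∫ q, fderiv ℝ f q (W q) ∂μ :=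
  setIntegral_eq_integral_of_forall_compl_eq_zero fun q hq => by
    simp [fderiv_of_notMem_tsupport (𝕜 := ℝ) fun hq' => hq (hf hq')]

variable [OpensMeasurableSpace E] [IsFiniteMeasureOnCompacts μ]

theorem integrable_fderiv_apply {f : E → ℝ} (hf : ContDiff ℝ 1 f) (hfc : HasCompactSupport f)
    {W : E → E} (hW : ContinuousOn W (tsupport f)) :
    Integrable (fun q => fderiv ℝ f q (W q)) μ := by
  have hsupp : Function.support (fun q => fderiv ℝ f q (W q)) ⊆ tsupport f := fun q hq =>
    by_contra fun hq' => hq (by simp [fderiv_of_notMem_tsupport (𝕜 := ℝ) hq'])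
  exact (integrableOn_iff_integrable_of_support_subset hsupp).1
    (((hf.continuous_fderiv one_ne_zero).continuousOn.clm_apply hW).integrableOn_compact'
      hfc (isClosed_tsupport f).measurableSet)

theorem integral_fderiv_nonpos_of_contDiff_one [FiniteDimensional ℝ E] {Ω : Set E}
    (hΩ : IsOpen Ω) {W : E → E} (hW : ContinuousOn W Ω)
    (h : ∀ ζ : E → ℝ, ContDiff ℝ ∞ ζ → HasCompactSupport ζ → tsupport ζ ⊆ Ω → (∀ q, 0 ≤ ζ q) →
      ∫ q in Ω, fderiv ℝ ζ q (W q) ∂μ ≤ 0)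
    {ζ : E → ℝ} (hζ : ContDiff ℝ 1 ζ) (hζc : HasCompactSupport ζ) (hζΩ : tsupport ζ ⊆ Ω)
    (hζ0 : ∀ q, 0 ≤ ζ q) : ∫ q, fderiv ℝ ζ q (W q) ∂μ ≤ 0 := by
  obtain ⟨δ, hδ, hδΩ⟩ := hζc.isCompact.exists_cthickening_subset_open hΩ hζΩ
  set K := Metric.cthickening δ (tsupport ζ)
  have hK : IsCompact K := hζc.isCompact.cthickening
  have hWK : IntegrableOn (fun q => ‖W q‖) K μ :=
    (hW.mono hδΩ).norm.integrableOn_compact' hK hK.measurableSet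
  set I := ∫ q in K, ‖W q‖ ∂μ
  have : 0 ≤ I := integral_nonneg fun q => norm_nonneg _
  refine le_of_forall_pos_le_add fun ε hε => ?_
  obtain ⟨ζ', hζ', hζ'K, hζ'0, hclose⟩ := exists_contDiff_abs_fderiv_sub_le hζ hζc hζ0 hδ
    (show 0 < ε / (I + 1) by positivity)
  have hζ'c : HasCompactSupport ζ' := hK.of_isClosed_subset (isClosed_tsupport _) hζ'K
  have hζ'int : Integrable (fun q => fderiv ℝ ζ' q (W q)) μ :=
    integrable_fderiv_apply (hζ'.of_le (by simp)) hζ'c (hW.mono (hζ'K.trans hδΩ))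
  calc ∫ q, fderiv ℝ ζ q (W q) ∂μ
      = ∫ q in K, fderiv ℝ ζ q (W q) ∂μ :=
        (setIntegral_fderiv_eq_integral (Metric.self_subset_cthickening _) W).symm
    _ ≤ ∫ q in K, (fderiv ℝ ζ' q (W q) + ε / (I + 1) * ‖W q‖) ∂μ :=
        integral_mono (integrable_fderiv_apply hζ hζc (hW.mono hζΩ)).integrableOn
          (hζ'int.integrableOn.add (hWK.const_mul _))
          fun q => by linarith [(abs_le.1 (hclose q (W q))).1]
    _ = ∫ q in Ω, fderiv ℝ ζ' q (W q) ∂μ + ε / (I + 1) * I := by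
        rw [integral_add hζ'int.integrableOn (hWK.const_mul _), integral_const_mul,
          setIntegral_fderiv_eq_integral hζ'K, setIntegral_fderiv_eq_integral (hζ'K.trans hδΩ)]
    _ ≤ 0 + ε := by
        gcongr
        · exact h ζ' hζ' hζ'c (hζ'K.trans hδΩ) hζ'0
        · rw [div_mul_eq_mul_div, div_le_iff₀ (by positivity)]
          linarith

end Mollification

theorem integral_mul_pos_of_tsupport_subset {Y : Type*} [TopologicalSpace Y]
    [MeasurableSpace Y] [OpensMeasurableSpace Y] {μ : Measure Y} [IsFiniteMeasureOnCompacts μ]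
    [μ.IsOpenPosMeasure] {B : Set Y} (hB : IsOpen B)
    {ζ d : Y → ℝ} (hζ : Continuous ζ) (hζc : HasCompactSupport ζ) (hζB : tsupport ζ ⊆ B)
    (hζ0 : ∀ q, 0 ≤ ζ q) (hd : ContinuousOn d B) (hd0 : ∀ q ∈ B, 0 < d q) {q₁ : Y}
    (hq₁ : 0 < ζ q₁) : 0 < ∫ q, ζ q * d q ∂μ := by
  have hcont : Continuous fun q => ζ q * d q := continuous_of_tsupport fun q hq =>
    hζ.continuousAt.mul (hd.continuousAt (hB.mem_nhds (hζB (tsupport_mul_subset_left hq))))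
  have hq₁B : q₁ ∈ B := hζB (subset_tsupport ζ hq₁.ne')
  refine hcont.integral_pos_of_hasCompactSupport_nonneg_nonzero hζc.mul_right (fun q => ?_)
    (mul_pos hq₁ (hd0 q₁ hq₁B)).ne'
  by_cases hq : q ∈ tsupport ζ
  · exact mul_nonneg (hζ0 q) (hd0 q (hζB hq)).le
  · simp [image_eq_zero_of_notMem_tsupport hq]

theorem contDiff_of_forall_mem_tsupport {E F : Type*} [NormedAddCommGroup E] [NormedSpace ℝ E]
    [NormedAddCommGroup F] [NormedSpace ℝ F] {n : WithTop ℕ∞} {f : E → F}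
    (h : ∀ q ∈ tsupport f, ContDiffAt ℝ n f q) : ContDiff ℝ n f :=
  contDiff_iff_contDiffAt.2 fun q => by
    by_cases hq : q ∈ tsupport f
    · exact h q hq
    · exact contDiffAt_const.congr_of_eventuallyEq (notMem_tsupport_iff_eventuallyEq.1 hq)

theorem exists_contDiff_fderiv_eq_smul {E : Type*} [NormedAddCommGroup E] [NormedSpace ℝ E]
    {B K : Set E} (hB : IsOpen B) (hK : IsClosed K) (hKB : K ⊆ B) {g : E → ℝ}
    (hg : ContDiffOn ℝ 1 g B) (hgK : ∀ q ∈ B, 0 < g q → q ∈ K) :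
    ∃ ζ : E → ℝ, ContDiff ℝ 1 ζ ∧ tsupport ζ ⊆ K ∧ (∀ q, 0 ≤ ζ q) ∧
      (∀ q ∈ B, 0 < g q → 0 < ζ q) ∧
      ∀ q ∈ B, ∃ c : ℝ, 0 ≤ c ∧ fderiv ℝ ζ q = c • fderiv ℝ g q := by
  set ζ : E → ℝ := B.indicator fun q => expNegInvGlue (g q) with hζ
  have hζB {q : E} (hq : q ∈ B) : ζ =ᶠ[𝓝 q] fun q => expNegInvGlue (g q) := by
    filter_upwards [hB.mem_nhds hq] with p hp
    exact indicator_of_mem hp _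
  have hgB {q : E} (hq : q ∈ B) : ContDiffAt ℝ 1 g q := hg.contDiffAt (hB.mem_nhds hq)
  have hsupp : tsupport ζ ⊆ K := closure_minimal (fun q hq => by
    have hqB : q ∈ B := mem_of_indicator_ne_zero hq
    refine hgK q hqB (not_le.1 fun hgq => hq ?_)
    rw [hζ, indicator_of_mem hqB, expNegInvGlue.zero_of_nonpos hgq]) hK
  refine ⟨ζ, contDiff_of_forall_mem_tsupport fun q hq => ?_, hsupp,
    indicator_nonneg fun _ _ => expNegInvGlue.nonneg _, fun q hq hgq => ?_, fun q hq => ?_⟩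
  · have hqB := hKB (hsupp hq)
    exact (expNegInvGlue.contDiff.contDiffAt.comp q (hgB hqB)).congr_of_eventuallyEq (hζB hqB)
  · rw [hζ, indicator_of_mem hq]
    exact expNegInvGlue.pos_of_pos hgq
  · refine ⟨deriv expNegInvGlue (g q), expNegInvGlue.monotone.deriv_nonneg, ?_⟩
    have hglue : DifferentiableAt ℝ expNegInvGlue (g q) :=
      (expNegInvGlue.contDiff (n := 1)).differentiable one_ne_zero _
    rw [(hζB hq).fderiv_eq]
    exact (hglue.hasDerivAt.comp_hasFDerivAt q
      ((hgB hq).differentiableAt one_ne_zero).hasFDerivAt).fderiv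

section Frame

variable {E ι : Type*} [NormedAddCommGroup E] [NormedSpace ℝ E]

/-- The gradient `(X₁ u, …, X_k u)` of `u` along a family `X` of vector fields. -/
noncomputable def frameGrad (X : ι → E → E) (u : E → ℝ) (q : E) : EuclideanSpace ℝ ι :=
  WithLp.toLp 2 fun i => fderiv ℝ u q (X i q)

variable {X : ι → E → E} {u v w ζ : E → ℝ} {q : E} {s : Set E}

theorem frameGrad_eq_smul_of_fderiv_eq {c : ℝ} (h : fderiv ℝ u q = c • fderiv ℝ v q) :
    frameGrad X u q = c • frameGrad X v q := by
  ext i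
  simp [frameGrad, h]

theorem frameGrad_add (hu : DifferentiableAt ℝ u q) (hv : DifferentiableAt ℝ v q) :
    frameGrad X (fun p => u p + v p) q = frameGrad X u q + frameGrad X v q := by
  ext i
  simp [frameGrad, fderiv_fun_add hu hv]

theorem frameGrad_sub (hu : DifferentiableAt ℝ u q) (hv : DifferentiableAt ℝ v q) :
    frameGrad X (fun p => u p - v p) q = frameGrad X u q - frameGrad X v q := by
  ext i
  simp [frameGrad, fderiv_fun_sub hu hv]

theorem frameGrad_const_sub (c : ℝ) : frameGrad X (fun p => c - u p) q = -frameGrad X u q := by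
  ext i
  simp [frameGrad, fderiv_const_sub]

theorem frameGrad_mul (hu : DifferentiableAt ℝ u q) (hv : DifferentiableAt ℝ v q) :
    frameGrad X (fun p => u p * v p) q = u q • frameGrad X v q + v q • frameGrad X u q := by
  ext i
  simp [frameGrad, fderiv_fun_mul hu hv]

theorem frameGrad_comp {g : ℝ → ℝ} (hg : DifferentiableAt ℝ g (w q))
    (hw : DifferentiableAt ℝ w q) :
    frameGrad X (fun p => g (w p)) q = deriv g (w q) • frameGrad X w q :=
  frameGrad_eq_smul_of_fderiv_eq (hg.hasDerivAt.comp_hasFDerivAt q hw.hasFDerivAt).fderiv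

theorem frameGrad_of_notMem_tsupport (hq : q ∉ tsupport u) : frameGrad X u q = 0 := by
  ext i
  simp [frameGrad, fderiv_of_notMem_tsupport (𝕜 := ℝ) hq]

theorem continuousOn_frameGrad (hX : ∀ i, Continuous (X i)) (hs : IsOpen s)
    (hu : ContDiffOn ℝ 1 u s) : ContinuousOn (frameGrad X u) s :=
  (PiLp.continuous_toLp 2 _).comp_continuousOn <| continuousOn_pi.2 fun i =>
    (hu.continuousOn_fderiv_of_isOpen hs le_rfl).clm_apply (hX i).continuousOn

theorem isOpen_frameGrad_ne_zero (hX : ∀ i, Continuous (X i)) (hw : ContDiff ℝ 1 w) :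
    IsOpen {q | frameGrad X w q ≠ 0} :=
  isOpen_ne_fun (continuousOn_univ.1 (continuousOn_frameGrad hX isOpen_univ hw.contDiffOn))
    continuous_const

variable [Fintype ι]

/-- The divergence `∑ Xᵢ fᵢ` of the field `∑ fᵢ Xᵢ`, as it comes out when the `Xᵢ` are
divergence free. -/
noncomputable def frameDiv (X : ι → E → E) (f : E → EuclideanSpace ℝ ι) (q : E) : ℝ :=
  ∑ i, fderiv ℝ (fun p => f p i) q (X i q)

/-- The tangent vector at `q` with components `a` along the vector fields `X`. -/
noncomputable def frameVector (X : ι → E → E) (a : EuclideanSpace ℝ ι) (q : E) : E :=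
  ∑ i, a i • X i q

variable {f : E → EuclideanSpace ℝ ι}

theorem inner_frameGrad (a : EuclideanSpace ℝ ι) :
    inner ℝ a (frameGrad X u q) = fderiv ℝ u q (frameVector X a q) := by
  simp [frameGrad, frameVector, PiLp.inner_apply, mul_comm]

theorem frameDiv_smul (hζ : DifferentiableAt ℝ ζ q) (hf : DifferentiableAt ℝ f q) :
    frameDiv X (fun p => ζ p • f p) q =
      inner ℝ (f q) (frameGrad X ζ q) + ζ q * frameDiv X f q := by
  rw [frameDiv, frameDiv, PiLp.inner_apply, Finset.mul_sum, ← Finset.sum_add_distrib]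
  refine Finset.sum_congr rfl fun i _ => ?_
  simp only [PiLp.smul_apply, smul_eq_mul]
  rw [fderiv_fun_mul hζ (differentiableAt_euclidean.1 hf i)]
  simp [frameGrad, add_comm, mul_comm]

theorem frameDiv_neg : frameDiv X (fun p => -f p) q = -frameDiv X f q := by
  simp [frameDiv, fderiv_fun_neg]

theorem frameDiv_of_notMem_tsupport (hq : q ∉ tsupport f) : frameDiv X f q = 0 := by
  refine Finset.sum_eq_zero fun i _ => ?_
  have hi : q ∉ tsupport fun p => f p i := fun h =>
    hq (tsupport_comp_subset (g := fun a : EuclideanSpace ℝ ι => a i) rfl f h)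
  simp [fderiv_of_notMem_tsupport (𝕜 := ℝ) hi]

theorem contDiffOn_frameGrad {n : WithTop ℕ∞} (hX : ∀ i, ContDiff ℝ n (X i)) (hs : IsOpen s)
    (hu : ContDiffOn ℝ (n + 1) u s) : ContDiffOn ℝ n (frameGrad X u) s :=
  contDiffOn_euclidean.2 fun i =>
    (hu.fderiv_of_isOpen hs le_rfl).clm_apply (hX i).contDiffOn

theorem continuousOn_frameDiv (hX : ∀ i, Continuous (X i)) (hs : IsOpen s)
    (hf : ContDiffOn ℝ 1 f s) : ContinuousOn (frameDiv X f) s :=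
  continuousOn_finsetSum _ fun i _ =>
    ((contDiffOn_euclidean.1 hf i).continuousOn_fderiv_of_isOpen hs le_rfl).clm_apply
      (hX i).continuousOn

theorem continuousOn_frameVector (hX : ∀ i, Continuous (X i)) (hf : ContinuousOn f s) :
    ContinuousOn (fun q => frameVector X (f q) q) s :=
  continuousOn_finsetSum _ fun i _ =>
    ((EuclideanSpace.proj i).continuous.comp_continuousOn hf).smul (hX i).continuousOn

end Frame

section WeakSubsolution

variable {E ι : Type*} [NormedAddCommGroup E] [NormedSpace ℝ E] [MeasurableSpace E]

/-- Each of the vector fields `Xᵢ` is divergence free with respect to `μ`, in the weak sense. -/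
def IsDivergenceFree (X : ι → E → E) (μ : Measure E) : Prop :=
  ∀ i, ∀ g : E → ℝ, ContDiff ℝ 1 g → HasCompactSupport g → ∫ q, fderiv ℝ g q (X i q) ∂μ = 0

variable [Fintype ι]

/-- `u` satisfies `div A(∇u) ≥ 0` weakly in `Ω`, the gradient being taken along the vector
fields `X`. -/
def IsWeakSubsolution (X : ι → E → E) (A : EuclideanSpace ℝ ι → EuclideanSpace ℝ ι)
    (μ : Measure E) (Ω : Set E) (u : E → ℝ) : Prop :=
  ∀ ζ : E → ℝ, ContDiff ℝ ∞ ζ → HasCompactSupport ζ → tsupport ζ ⊆ Ω → (∀ q, 0 ≤ ζ q) →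
    ∫ q in Ω, inner ℝ (A (frameGrad X u q)) (frameGrad X ζ q) ∂μ ≤ 0

variable [OpensMeasurableSpace E] {X : ι → E → E} {μ : Measure E} [IsFiniteMeasureOnCompacts μ]
  {A : EuclideanSpace ℝ ι → EuclideanSpace ℝ ι} {Ω B K : Set E} {u v : E → ℝ}

theorem integrable_inner_frameGrad (hX : ∀ i, Continuous (X i)) {f : E → EuclideanSpace ℝ ι}
    {ζ : E → ℝ} (hζ : ContDiff ℝ 1 ζ) (hζc : HasCompactSupport ζ)
    (hf : ContinuousOn f (tsupport ζ)) :
    Integrable (fun q => inner ℝ (f q) (frameGrad X ζ q)) μ := by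
  simp only [inner_frameGrad]
  exact integrable_fderiv_apply hζ hζc (continuousOn_frameVector hX hf)

theorem IsWeakSubsolution.integral_nonpos [FiniteDimensional ℝ E]
    (hu : IsWeakSubsolution X A μ Ω u) (hX : ∀ i, Continuous (X i)) (hΩ : IsOpen Ω)
    (hflux : ContinuousOn (fun q => A (frameGrad X u q)) Ω) {ζ : E → ℝ} (hζ : ContDiff ℝ 1 ζ)
    (hζc : HasCompactSupport ζ) (hζΩ : tsupport ζ ⊆ Ω) (hζ0 : ∀ q, 0 ≤ ζ q) :
    ∫ q, inner ℝ (A (frameGrad X u q)) (frameGrad X ζ q) ∂μ ≤ 0 := by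
  simp only [inner_frameGrad]
  refine integral_fderiv_nonpos_of_contDiff_one hΩ (continuousOn_frameVector hX hflux)
    (fun ζ hζ hζc hζΩ hζ0 => ?_) hζ hζc hζΩ hζ0
  simpa only [inner_frameGrad] using hu ζ hζ hζc hζΩ hζ0

theorem IsDivergenceFree.integral_frameDiv_eq_zero (hdiv : IsDivergenceFree X μ)
    (hX : ∀ i, Continuous (X i)) {g : E → EuclideanSpace ℝ ι} (hg : ContDiff ℝ 1 g)
    (hgc : HasCompactSupport g) : ∫ q, frameDiv X g q ∂μ = 0 := by
  have hgi (i : ι) : ContDiff ℝ 1 fun q => g q i := contDiff_euclidean.1 hg i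
  have hgic (i : ι) : HasCompactSupport fun q => g q i :=
    hgc.comp_left (g := fun a : EuclideanSpace ℝ ι => a i) rfl
  simp only [frameDiv]
  rw [integral_finsetSum _ fun i _ =>
    integrable_fderiv_apply (hgi i) (hgic i) (hX i).continuousOn]
  exact Finset.sum_eq_zero fun i _ => hdiv i _ (hgi i) (hgic i)

theorem IsDivergenceFree.integral_inner_frameGrad (hdiv : IsDivergenceFree X μ)
    (hX : ∀ i, Continuous (X i)) (hB : IsOpen B) {f : E → EuclideanSpace ℝ ι}
    (hf : ContDiffOn ℝ 1 f B) {ζ : E → ℝ} (hζ : ContDiff ℝ 1 ζ) (hζc : HasCompactSupport ζ)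
    (hζB : tsupport ζ ⊆ B) :
    ∫ q, inner ℝ (f q) (frameGrad X ζ q) ∂μ = -∫ q, ζ q * frameDiv X f q ∂μ := by
  have hfat {q : E} (hq : q ∈ tsupport ζ) : ContDiffAt ℝ 1 f q :=
    hf.contDiffAt (hB.mem_nhds (hζB hq))
  have hsupp : tsupport (fun q => ζ q • f q) ⊆ tsupport ζ := tsupport_smul_subset_left ζ f
  have hζf : ContDiff ℝ 1 fun q => ζ q • f q := contDiff_of_forall_mem_tsupport fun q hq =>
    hζ.contDiffAt.smul (hfat (hsupp hq))
  have hprod (q : E) : frameDiv X (fun q => ζ q • f q) q =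
      inner ℝ (f q) (frameGrad X ζ q) + ζ q * frameDiv X f q := by
    by_cases hq : q ∈ tsupport ζ
    · exact frameDiv_smul (hζ.differentiable one_ne_zero q)
        ((hfat hq).differentiableAt one_ne_zero)
    · rw [frameDiv_of_notMem_tsupport fun h => hq (hsupp h), frameGrad_of_notMem_tsupport hq,
        image_eq_zero_of_notMem_tsupport hq, inner_zero_right, zero_mul, add_zero]
  have hint : Integrable (fun q => ζ q * frameDiv X f q) μ :=
    (integrableOn_iff_integrable_of_support_subset
      ((Function.support_mul_subset_left ζ _).trans (subset_tsupport ζ))).1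
      ((hζ.continuous.continuousOn.mul ((continuousOn_frameDiv hX hB hf).mono hζB)
        ).integrableOn_compact' hζc (isClosed_tsupport ζ).measurableSet)
  have hzero := hdiv.integral_frameDiv_eq_zero hX hζf hζc.smul_right
  simp only [hprod] at hzero
  rw [integral_add (integrable_inner_frameGrad hX hζ hζc fun q hq =>
    (hfat hq).continuousAt.continuousWithinAt) hint] at hzero
  exact eq_neg_of_add_eq_zero_left hzero

variable [FiniteDimensional ℝ E] [μ.IsOpenPosMeasure]

theorem IsWeakSubsolution.le_add_of_superlevel_subset (hu : IsWeakSubsolution X A μ Ω u)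
    (hdiv : IsDivergenceFree X μ) (hX : ∀ i, Continuous (X i)) (hA : Continuous A)
    (hmono : ∀ a b, 0 ≤ inner ℝ (A a - A b) (a - b)) (hΩ : IsOpen Ω) (huΩ : ContDiffOn ℝ 1 u Ω)
    (hB : IsOpen B) (hBΩ : B ⊆ Ω) (hK : IsCompact K) (hKB : K ⊆ B) (hv : ContDiffOn ℝ 1 v B)
    (hflux : ContDiffOn ℝ 1 (fun q => A (frameGrad X v q)) B)
    (hneg : ∀ q ∈ B, frameDiv X (fun q => A (frameGrad X v q)) q < 0) {ε : ℝ}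
    (huv : ∀ q ∈ B, v q + ε < u q → q ∈ K) : ∀ q ∈ B, u q ≤ v q + ε := by
  by_contra! ⟨q₁, hq₁, huq₁⟩
  have huB : ContDiffOn ℝ 1 u B := huΩ.mono hBΩ
  obtain ⟨ζ, hζ, hζK, hζ0, hζpos, hζd⟩ :=
    exists_contDiff_fderiv_eq_smul (g := fun q => u q - v q - ε) hB hK.isClosed hKB
      ((huB.sub hv).sub contDiffOn_const) fun q hq hq' => huv q hq (by linarith)
  have hζB : tsupport ζ ⊆ B := hζK.trans hKB
  have hζc : HasCompactSupport ζ := hK.of_isClosed_subset (isClosed_tsupport _) hζK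
  have hfluxu : ContinuousOn (fun q => A (frameGrad X u q)) Ω :=
    hA.comp_continuousOn (continuousOn_frameGrad hX hΩ huΩ)
  have hle (q : E) : inner ℝ (A (frameGrad X v q)) (frameGrad X ζ q) ≤
      inner ℝ (A (frameGrad X u q)) (frameGrad X ζ q) := by
    by_cases hq : q ∈ tsupport ζ
    · obtain ⟨k, hk, hζk⟩ := hζd q (hζB hq)
      have hdu := (huB.contDiffAt (hB.mem_nhds (hζB hq))).differentiableAt one_ne_zero
      have hdv := (hv.contDiffAt (hB.mem_nhds (hζB hq))).differentiableAt one_ne_zero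
      rw [fderiv_sub_const] at hζk
      rw [← sub_nonneg, ← inner_sub_left, frameGrad_eq_smul_of_fderiv_eq hζk,
        frameGrad_sub hdu hdv, real_inner_smul_right]
      exact mul_nonneg hk (hmono _ _)
    · rw [frameGrad_of_notMem_tsupport hq, inner_zero_right, inner_zero_right]
  have hlower : 0 < ∫ q, inner ℝ (A (frameGrad X v q)) (frameGrad X ζ q) ∂μ := by
    rw [hdiv.integral_inner_frameGrad hX hB hflux hζ hζc hζB, ← integral_neg]
    simp only [← mul_neg]
    exact integral_mul_pos_of_tsupport_subset hB hζ.continuous hζc hζB hζ0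
      (continuousOn_frameDiv hX hB hflux).neg (fun q hq => neg_pos.2 (hneg q hq))
      (hζpos q₁ hq₁ (by linarith))
  have hupper := hu.integral_nonpos hX hΩ hfluxu hζ hζc (hζB.trans hBΩ) hζ0
  exact hupper.not_gt (hlower.trans_le (integral_mono
    (integrable_inner_frameGrad hX hζ hζc (hflux.continuousOn.mono hζB))
    (integrable_inner_frameGrad hX hζ hζc (hfluxu.mono (hζB.trans hBΩ))) hle))

theorem IsWeakSubsolution.le_of_le_on_frontier (hu : IsWeakSubsolution X A μ Ω u)
    (hdiv : IsDivergenceFree X μ) (hX : ∀ i, Continuous (X i)) (hA : Continuous A)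
    (hmono : ∀ a b, 0 ≤ inner ℝ (A a - A b) (a - b)) (hΩ : IsOpen Ω) (huΩ : ContDiffOn ℝ 1 u Ω)
    (hB : IsOpen B) (hBb : Bornology.IsBounded B) (hBΩ : closure B ⊆ Ω)
    (hv : ContDiffOn ℝ 1 v B) (hvc : ContinuousOn v (closure B))
    (hflux : ContDiffOn ℝ 1 (fun q => A (frameGrad X v q)) B)
    (hneg : ∀ q ∈ B, frameDiv X (fun q => A (frameGrad X v q)) q < 0)
    (huv : ∀ q ∈ frontier B, u q ≤ v q) : ∀ q ∈ B, u q ≤ v q := by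
  intro q hq
  refine le_of_forall_pos_le_add fun ε hε => ?_
  have hdiff : ContinuousOn (fun q => u q - v q) (closure B) :=
    (huΩ.continuousOn.mono hBΩ).sub hvc
  have hK : IsCompact (closure B ∩ (fun q => u q - v q) ⁻¹' Ici ε) :=
    hBb.isCompact_closure.of_isClosed_subset
      (hdiff.preimage_isClosed_of_isClosed isClosed_closure isClosed_Ici) inter_subset_left
  refine hu.le_add_of_superlevel_subset hdiv hX hA hmono hΩ huΩ hB (subset_closure.trans hBΩ)
    hK (fun p ⟨hp, hεp⟩ => ?_) hv hflux hneg
    (fun p hp hεp => ⟨subset_closure hp, (lt_sub_iff_add_lt'.2 hεp).le⟩) q hq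
  by_contra hpB
  have hpf : p ∈ frontier B := by rw [hB.frontier_eq]; exact ⟨hp, hpB⟩
  have hεp' : ε ≤ u p - v p := hεp
  linarith [huv p hpf]

end WeakSubsolution

section RadialFlux

variable {V : Type*} [NormedAddCommGroup V] [InnerProductSpace ℝ V] {φ : ℝ → ℝ}

/-- The vector in the direction of `a` whose length is `φ ‖a‖`; it is `0` at `a = 0`. -/
noncomputable def radialFlux (φ : ℝ → ℝ) (a : V) : V := (‖a‖⁻¹ * φ ‖a‖) • a

theorem radialFlux_neg (a : V) : radialFlux φ (-a) = -radialFlux φ a := by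
  rw [radialFlux, norm_neg, smul_neg, radialFlux]

theorem radialFlux_smul {t : ℝ} (ht : 0 < t) (a : V) :
    radialFlux φ (t • a) = φ (t * ‖a‖) • ‖a‖⁻¹ • a := by
  rw [radialFlux, norm_smul, Real.norm_of_nonneg ht.le, smul_smul, smul_smul]
  congr 1
  field_simp

theorem norm_radialFlux (h0 : φ 0 = 0) (a : V) : ‖radialFlux φ a‖ = |φ ‖a‖| := by
  rcases eq_or_ne a 0 with rfl | ha
  · simp [radialFlux, h0]
  · rw [radialFlux, norm_smul, norm_mul, norm_inv, norm_norm, Real.norm_eq_abs, mul_right_comm,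
      inv_mul_cancel₀ (norm_ne_zero_iff.2 ha), one_mul]

theorem inner_radialFlux_self (a : V) : inner ℝ (radialFlux φ a) a = φ ‖a‖ * ‖a‖ := by
  rcases eq_or_ne a 0 with rfl | ha
  · simp
  · rw [radialFlux, real_inner_smul_left, real_inner_self_eq_norm_sq]
    field_simp [norm_ne_zero_iff.2 ha]

theorem continuous_radialFlux (hφ : ContinuousOn φ (Ici 0)) (h0 : φ 0 = 0) :
    Continuous (radialFlux φ : V → V) := by
  have hφn : Continuous fun a : V => φ ‖a‖ := hφ.comp_continuous continuous_norm norm_nonneg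
  refine continuous_iff_continuousAt.2 fun a => ?_
  rcases eq_or_ne a 0 with rfl | ha
  · rw [ContinuousAt, radialFlux, smul_zero, tendsto_zero_iff_norm_tendsto_zero]
    simp only [norm_radialFlux h0]
    simpa [h0] using hφn.abs.tendsto 0
  · exact ((continuous_norm.continuousAt.inv₀ (norm_ne_zero_iff.2 ha)).mul
      hφn.continuousAt).smul continuousAt_id

theorem inner_radialFlux_sub_nonneg (hφ : MonotoneOn φ (Ici 0)) (h0 : φ 0 = 0) (a b : V) :
    0 ≤ inner ℝ (radialFlux φ a - radialFlux φ b) (a - b) := by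
  have hcs (a b : V) : inner ℝ (radialFlux φ a) b ≤ φ ‖a‖ * ‖b‖ := by
    have hpos : 0 ≤ φ ‖a‖ := h0 ▸ hφ self_mem_Ici (norm_nonneg a) (norm_nonneg a)
    simpa [norm_radialFlux h0, abs_of_nonneg hpos] using real_inner_le_norm (radialFlux φ a) b
  have hmono : 0 ≤ (φ ‖a‖ - φ ‖b‖) * (‖a‖ - ‖b‖) := by
    rcases le_total ‖a‖ ‖b‖ with h | h
    · exact mul_nonneg_of_nonpos_of_nonpos
        (sub_nonpos.2 (hφ (norm_nonneg a) (norm_nonneg b) h)) (sub_nonpos.2 h)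
    · exact mul_nonneg (sub_nonneg.2 (hφ (norm_nonneg b) (norm_nonneg a) h)) (sub_nonneg.2 h)
  rw [inner_sub_left, inner_sub_right, inner_sub_right, inner_radialFlux_self,
    inner_radialFlux_self]
  linarith [hcs a b, hcs b a]

end RadialFlux

section Barrier

variable {E ι : Type*} [NormedAddCommGroup E] [NormedSpace ℝ E] [Fintype ι]
  {X : ι → E → E} {φ η : ℝ → ℝ} {w : E → ℝ} {K : Set E}

/-- The unit normal `∇w / ‖∇w‖` to the level sets of `w`; it is `0` where `∇w = 0`. -/
noncomputable def frameNormal (X : ι → E → E) (w : E → ℝ) (q : E) : EuclideanSpace ℝ ι :=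
  ‖frameGrad X w q‖⁻¹ • frameGrad X w q

theorem inner_frameNormal_frameGrad (q : E) :
    inner ℝ (frameNormal X w q) (frameGrad X w q) = ‖frameGrad X w q‖ := by
  rw [frameNormal, real_inner_smul_left, real_inner_self_eq_norm_mul_norm, ← mul_assoc,
    inv_mul_mul_self]

theorem contDiffOn_norm_frameGrad (hX : ∀ i, ContDiff ℝ 1 (X i)) (hw : ContDiff ℝ 2 w) :
    ContDiffOn ℝ 1 (fun q => ‖frameGrad X w q‖) {q | frameGrad X w q ≠ 0} := by
  have hgrad : ContDiffOn ℝ 1 (frameGrad X w) univ :=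
    contDiffOn_frameGrad hX isOpen_univ (by simpa [one_add_one_eq_two] using hw.contDiffOn)
  exact (hgrad.mono (subset_univ _)).norm ℝ fun _ hq => hq

theorem contDiffOn_frameNormal (hX : ∀ i, ContDiff ℝ 1 (X i)) (hw : ContDiff ℝ 2 w) :
    ContDiffOn ℝ 1 (frameNormal X w) {q | frameGrad X w q ≠ 0} := by
  have hgrad : ContDiffOn ℝ 1 (frameGrad X w) univ :=
    contDiffOn_frameGrad hX isOpen_univ (by simpa [one_add_one_eq_two] using hw.contDiffOn)
  exact ((contDiffOn_norm_frameGrad hX hw).inv fun _ hq => norm_ne_zero_iff.2 hq).smul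
    (hgrad.mono (subset_univ _))

theorem radialFlux_frameGrad_comp (hη : Differentiable ℝ η) (hη0 : ∀ y, 0 < deriv η y)
    (hw : Differentiable ℝ w) :
    (fun q => radialFlux φ (frameGrad X (fun p => η (w p)) q)) =
      fun q => φ (deriv η (w q) * ‖frameGrad X w q‖) • frameNormal X w q := by
  ext1 q
  rw [frameGrad_comp (hη _) (hw q), radialFlux_smul (hη0 _), frameNormal]

theorem PhiStructural.contDiffOn_comp_slope (hφ : PhiStructural φ) (hX : ∀ i, ContDiff ℝ 1 (X i))
    (hη : ContDiff ℝ 2 η) (hη0 : ∀ y, 0 < deriv η y) (hw : ContDiff ℝ 2 w) :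
    ContDiffOn ℝ 1 (fun q => φ (deriv η (w q) * ‖frameGrad X w q‖))
      {q | frameGrad X w q ≠ 0} :=
  hφ.contDiffOn.comp (((hη.deriv'.comp (hw.of_le one_le_two)).contDiffOn).mul
    (contDiffOn_norm_frameGrad hX hw)) fun _ hq => mul_pos (hη0 _) (norm_pos_iff.2 hq)

theorem PhiStructural.contDiffOn_radialFlux (hφ : PhiStructural φ) (hX : ∀ i, ContDiff ℝ 1 (X i))
    (hη : ContDiff ℝ 2 η) (hη0 : ∀ y, 0 < deriv η y) (hw : ContDiff ℝ 2 w) :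
    ContDiffOn ℝ 1 (fun q => radialFlux φ (frameGrad X (fun p => η (w p)) q))
      {q | frameGrad X w q ≠ 0} := by
  rw [radialFlux_frameGrad_comp (hη.differentiable two_ne_zero) hη0
    (hw.differentiable two_ne_zero)]
  exact (hφ.contDiffOn_comp_slope hX hη hη0 hw).smul (contDiffOn_frameNormal hX hw)

theorem PhiStructural.frameDiv_radialFlux (hφ : PhiStructural φ) (hX : ∀ i, ContDiff ℝ 1 (X i))
    (hη : ContDiff ℝ 2 η) (hη0 : ∀ y, 0 < deriv η y) (hw : ContDiff ℝ 2 w) {q : E}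
    (hq : frameGrad X w q ≠ 0) :
    frameDiv X (fun q => radialFlux φ (frameGrad X (fun p => η (w p)) q)) q =
      φ (deriv η (w q) * ‖frameGrad X w q‖) * frameDiv X (frameNormal X w) q +
      deriv φ (deriv η (w q) * ‖frameGrad X w q‖) *
        (deriv η (w q) *
            inner ℝ (frameNormal X w q) (frameGrad X (fun p => ‖frameGrad X w p‖) q) +
          deriv (deriv η) (w q) * ‖frameGrad X w q‖ ^ 2) := by
  have hU := (isOpen_frameGrad_ne_zero (fun i => (hX i).continuous)
    (hw.of_le one_le_two)).mem_nhds hq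
  have hwd : DifferentiableAt ℝ w q := hw.differentiable two_ne_zero q
  have hη' : DifferentiableAt ℝ (deriv η) (w q) := hη.deriv'.differentiable one_ne_zero _
  have hηd : DifferentiableAt ℝ (fun p => deriv η (w p)) q := hη'.comp q hwd
  have hNd := ((contDiffOn_norm_frameGrad hX hw).contDiffAt hU).differentiableAt one_ne_zero
  have hnd := ((contDiffOn_frameNormal hX hw).contDiffAt hU).differentiableAt one_ne_zero
  have hφd := ((hφ.contDiffOn_comp_slope hX hη hη0 hw).contDiffAt hU).differentiableAt one_ne_zero
  have hφ' := (hφ.hasDerivAt (mul_pos (hη0 (w q)) (norm_pos_iff.2 hq))).differentiableAt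
  rw [radialFlux_frameGrad_comp (hη.differentiable two_ne_zero) hη0
    (hw.differentiable two_ne_zero), frameDiv_smul hφd hnd,
    frameGrad_comp (w := fun q => deriv η (w q) * ‖frameGrad X w q‖) hφ'
      (hηd.mul hNd), frameGrad_mul hηd hNd, frameGrad_comp hη' hwd]
  simp only [real_inner_smul_right, inner_add_right, inner_frameNormal_frameGrad]
  ring

theorem PhiStructural.add_mul_slope_pos (hφ : PhiStructural φ) {D : ℝ}
    (hD : AlmostMonotone D fun x => Real.exp x * deriv φ (Real.exp x)) {A C N t t' α β : ℝ}
    (hC : 0 ≤ C) (ht : 0 < t) (hN : 1 ≤ N) (hNA : N ≤ A) (hα : -C ≤ α) (hβ : -C ≤ β)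
    (ht' : t' = (C * (D * A ^ 2) + C + 1) * (t + φ t / deriv φ t)) :
    0 < φ (t * N) * β + deriv φ (t * N) * (t * α + t' * N ^ 2) := by
  have htN : 0 < t * N := by positivity
  have hφ' : 0 < deriv φ (t * N) := hφ.deriv_pos _ htN
  have hD0 : 0 < D := one_pos.trans_le (hD.one_le (hφ.exp_mul_deriv_pos 0))
  have hr : 0 < φ t / deriv φ t := div_pos (hφ.pos ht) (hφ.deriv_pos t ht)
  have hgrowth : φ (t * N) ≤ D * A ^ 2 * deriv φ (t * N) * (t + φ t / deriv φ t) :=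
    hφ.le_mul_deriv_mul hD ht (le_mul_of_one_le_right ht.le hN) (by rw [mul_comm]; gcongr)
  have ht'0 : 0 ≤ t' := by rw [ht']; positivity
  calc 0 < deriv φ (t * N) * ((C + 1) * (φ t / deriv φ t) + t) := by positivity
    _ = D * A ^ 2 * deriv φ (t * N) * (t + φ t / deriv φ t) * -C +
        deriv φ (t * N) * (t * -C + t') := by rw [ht']; ring
    _ ≤ φ (t * N) * -C + deriv φ (t * N) * (t * α + t' * N ^ 2) := by
        gcongr ?_ + _ * (_ * ?_ + ?_)
        · exact mul_le_mul_of_nonpos_right hgrowth (neg_nonpos.2 hC)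
        · exact le_mul_of_one_le_right ht'0 (one_le_pow₀ hN)
    _ ≤ φ (t * N) * β + deriv φ (t * N) * (t * α + t' * N ^ 2) := by
        gcongr
        exact (hφ.pos htN).le

theorem PhiStructural.exists_barrier (hφ : PhiStructural φ) (hφ2 : PhiRelaxedHomogeneous φ)
    (hX : ∀ i, ContDiff ℝ 1 (X i)) (hw : ContDiff ℝ 2 w) (hK : IsCompact K)
    (hwK : ∀ q ∈ K, 1 ≤ ‖frameGrad X w q‖) {δ : ℝ} (hδ : 0 < δ) :
    ∃ η : ℝ → ℝ, ContDiff ℝ 2 η ∧ η 0 = 0 ∧ (∀ y, 0 < deriv η y) ∧ (∀ q ∈ K, η (w q) ≤ δ) ∧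
      ∀ q ∈ K, 0 < frameDiv X (fun q => radialFlux φ (frameGrad X (fun p => η (w p)) q)) q := by
  obtain ⟨D, hD⟩ := hφ2.exists_almostMonotone hφ
  have hXc (i : ι) : Continuous (X i) := (hX i).continuous
  have hU := isOpen_frameGrad_ne_zero hXc (hw.of_le one_le_two)
  have hKU : K ⊆ {q | frameGrad X w q ≠ 0} := fun q hq =>
    norm_pos_iff.1 (one_pos.trans_le (hwK q hq))
  have hN := contDiffOn_norm_frameGrad hX hw
  have hn := contDiffOn_frameNormal hX hw
  obtain ⟨A, hA⟩ := hK.exists_bound_of_continuousOn (hN.continuousOn.mono hKU)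
  obtain ⟨C₁, hC₁⟩ := hK.exists_bound_of_continuousOn
    ((hn.continuousOn.inner (𝕜 := ℝ) (continuousOn_frameGrad hXc hU hN)).mono hKU)
  obtain ⟨C₂, hC₂⟩ := hK.exists_bound_of_continuousOn ((continuousOn_frameDiv hXc hU hn).mono hKU)
  obtain ⟨b, hb⟩ := hK.exists_bound_of_continuousOn hw.continuous.continuousOn
  have hD0 : 0 < D := one_pos.trans_le (hD.one_le (hφ.exp_mul_deriv_pos 0))
  set C := max (max C₁ C₂) 0
  have hC : 0 ≤ C := le_max_right _ _
  obtain ⟨η, hη, hη0, hη', hηδ, hode⟩ := hφ.exists_profile hD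
    (M := C * (D * A ^ 2) + C + 1) (b := max b 1) (by positivity) hδ (by positivity)
  have hwb (q : E) (hq : q ∈ K) : w q ≤ max b 1 :=
    ((le_abs_self _).trans (hb q hq)).trans (le_max_left _ _)
  refine ⟨η, hη, hη0, hη', fun q hq => hηδ _ (hwb q hq), fun q hq => ?_⟩
  rw [hφ.frameDiv_radialFlux hX hη hη' hw (hKU hq)]
  exact hφ.add_mul_slope_pos hD hC (hη' _) (hwK q hq) ((le_abs_self _).trans (hA q hq))
    (abs_le.1 ((hC₁ q hq).trans ((le_max_left C₁ C₂).trans (le_max_left _ 0)))).1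
    (abs_le.1 ((hC₂ q hq).trans ((le_max_right C₁ C₂).trans (le_max_left _ 0)))).1
    (hode _ (hwb q hq))

end Barrier

section BoundaryPoint

variable {E ι : Type*} [NormedAddCommGroup E] [NormedSpace ℝ E] {X : ι → E → E}

theorem frameGrad_eq_zero_of_isLocalExtr {u : E → ℝ} {q : E} (h : IsLocalExtr u q) :
    frameGrad X u q = 0 := by
  ext i
  simp [frameGrad, h.fderiv_eq_zero]

variable [Fintype ι] [FiniteDimensional ℝ E] {q₀ : E} {u v w : E → ℝ}

theorem exists_strict_isLocalMaxOn {n : WithTop ℕ∞} (hn : n ≠ 0) {F : Set E}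
    (hw : ContDiff ℝ n w) (hw₀ : frameGrad X w q₀ ≠ 0) (hmax : IsLocalMaxOn w F q₀) {a : ℝ}
    (ha : 0 < a) :
    ∃ v : E → ℝ, ContDiff ℝ n v ∧ v q₀ = 0 ∧ ‖frameGrad X v q₀‖ = a ∧
      ∀ᶠ q in 𝓝[F] q₀, 0 ≤ v q → q = q₀ := by
  set k : ℝ := a / ‖frameGrad X w q₀‖ with hk
  have hk0 : 0 < k := div_pos ha (norm_pos_iff.2 hw₀)
  set Q : E → ℝ := fun q => ‖toEuclidean (q - q₀)‖ ^ 2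
  have hQ : ContDiff ℝ n Q :=
    (toEuclidean.contDiff.comp (contDiff_id.sub contDiff_const)).norm_sq ℝ
  have hQ₀ : frameGrad X Q q₀ = 0 := frameGrad_eq_zero_of_isLocalExtr
    (Or.inl (Eventually.of_forall fun q => by simp [Q]))
  have hwd : DifferentiableAt ℝ w q₀ := hw.differentiable hn q₀
  have hlin : frameGrad X (fun q => k * (w q - w q₀)) q₀ = k • frameGrad X w q₀ :=
    frameGrad_eq_smul_of_fderiv_eq (by
      rw [fderiv_const_mul (hwd.sub_const _), fderiv_sub_const])
  refine ⟨fun q => k * (w q - w q₀) - Q q,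
    (contDiff_const.mul (hw.sub contDiff_const)).sub hQ, by simp [Q], ?_, ?_⟩
  · rw [frameGrad_sub ((hwd.sub_const _).const_mul k) (hQ.differentiable hn q₀), hlin, hQ₀,
      sub_zero, norm_smul, Real.norm_of_nonneg hk0.le, hk,
      div_mul_cancel₀ _ (norm_ne_zero_iff.2 hw₀)]
  · filter_upwards [hmax] with q hq hvq
    have hQ0 : Q q ≤ 0 := by
      linarith [mul_nonpos_of_nonneg_of_nonpos hk0.le (sub_nonpos.2 hq)]
    simpa [Q, sub_eq_zero] using hQ0

variable [MeasurableSpace E] [OpensMeasurableSpace E] {μ : Measure E}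
  [IsFiniteMeasureOnCompacts μ] [μ.IsOpenPosMeasure] {φ : ℝ → ℝ} {Ω : Set E} {c : ℝ}

theorem IsWeakSubsolution.exists_add_barrier_le (hφ : PhiStructural φ)
    (hφ2 : PhiRelaxedHomogeneous φ) (hX : ∀ i, ContDiff ℝ 1 (X i)) (hdiv : IsDivergenceFree X μ)
    (hΩ : IsOpen Ω) (huΩ : ContDiffOn ℝ 1 u Ω) (hu : IsWeakSubsolution X (radialFlux φ) μ Ω u)
    (hle : ∀ q ∈ Ω, u q ≤ c) {B : Set E} (hB : IsOpen B) (hBb : Bornology.IsBounded B)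
    (hBΩ : closure B ⊆ Ω) (hv : ContDiff ℝ 2 v) (hvB : ∀ q ∈ closure B, 1 ≤ ‖frameGrad X v q‖)
    (hvu : ∀ q ∈ frontier B, 0 ≤ v q → u q < c) :
    ∃ η : ℝ → ℝ, ContDiff ℝ 2 η ∧ η 0 = 0 ∧ (∀ y, 0 < deriv η y) ∧
      ∀ q ∈ B, u q + η (v q) ≤ c := by
  have hcontact : IsCompact (frontier B ∩ v ⁻¹' Ici 0) :=
    (hBb.isCompact_closure.of_isClosed_subset isClosed_frontier frontier_subset_closure
      ).inter_right (isClosed_Ici.preimage hv.continuous)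
  obtain ⟨δ, hδ, hδu⟩ := hcontact.exists_forall_le' (f := fun q => c - u q) (a := 0)
    (continuousOn_const.sub (huΩ.continuousOn.mono
      ((inter_subset_left.trans frontier_subset_closure).trans hBΩ)))
    fun q hq => sub_pos.2 (hvu q hq.1 hq.2)
  obtain ⟨η, hη, hη0, hη', hηδ, hpos⟩ := hφ.exists_barrier hφ2 hX hv hBb.isCompact_closure hvB hδ
  have hηv : ContDiff ℝ 2 fun q => c - η (v q) := contDiff_const.sub (hη.comp hv)
  have hflux : (fun q => radialFlux φ (frameGrad X (fun p => c - η (v p)) q)) =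
      fun q => -radialFlux φ (frameGrad X (fun p => η (v p)) q) := by
    simp only [frameGrad_const_sub, radialFlux_neg]
  refine ⟨η, hη, hη0, hη', fun q hq => le_sub_iff_add_le.1 (hu.le_of_le_on_frontier hdiv
    (fun i => (hX i).continuous) (continuous_radialFlux hφ.continuousOn hφ.map_zero)
    (inner_radialFlux_sub_nonneg hφ.strictMonoOn.monotoneOn hφ.map_zero) hΩ huΩ hB hBb hBΩ
    (hηv.of_le one_le_two).contDiffOn hηv.continuous.continuousOn ?_ ?_ ?_ q hq)⟩
  · rw [hflux]
    exact ((hφ.contDiffOn_radialFlux hX hη hη' hv).neg).mono fun q hq =>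
      norm_pos_iff.1 (one_pos.trans_le (hvB q (subset_closure hq)))
  · intro q hq
    rw [hflux, frameDiv_neg]
    exact neg_neg_of_pos (hpos q (subset_closure hq))
  · intro q hq
    have hqB := frontier_subset_closure hq
    rcases le_total 0 (v q) with hvq | hvq
    · linarith [hδu q ⟨hq, hvq⟩, hηδ q hqB]
    · linarith [hle q (hBΩ hqB), hη0 ▸ (strictMono_of_deriv_pos hη').monotone hvq]

theorem IsWeakSubsolution.frameGrad_eq_zero_of_isLocalMaxOn (hφ : PhiStructural φ)
    (hφ2 : PhiRelaxedHomogeneous φ) (hX : ∀ i, ContDiff ℝ 1 (X i)) (hdiv : IsDivergenceFree X μ)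
    (hΩ : IsOpen Ω) (huΩ : ContDiffOn ℝ 1 u Ω) (hu : IsWeakSubsolution X (radialFlux φ) μ Ω u)
    (hle : ∀ q ∈ Ω, u q ≤ c) (hq₀ : q₀ ∈ Ω) (huq₀ : u q₀ = c) (hw : ContDiff ℝ 2 w)
    (hmax : IsLocalMaxOn w (Ω ∩ u ⁻¹' {c}) q₀) : frameGrad X w q₀ = 0 := by
  by_contra hw₀
  obtain ⟨v, hv, hv₀, hnorm, hstrict⟩ := exists_strict_isLocalMaxOn two_ne_zero hw hw₀ hmax two_pos
  have hgrad : Continuous (frameGrad X v) := continuousOn_univ.1 (continuousOn_frameGrad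
    (fun i => (hX i).continuous) isOpen_univ (hv.of_le one_le_two).contDiffOn)
  have hlarge : ∀ᶠ q in 𝓝 q₀, 1 < ‖frameGrad X v q‖ :=
    hgrad.norm.continuousAt.eventually (lt_mem_nhds (by norm_num [hnorm]))
  obtain ⟨r, hr, hball⟩ := Metric.nhds_basis_closedBall.eventually_iff.1
    ((hΩ.eventually_mem hq₀).and (hlarge.and (eventually_nhdsWithin_iff.1 hstrict)))
  have hcl {q : E} (hq : q ∈ closure (Metric.ball q₀ r)) : q ∈ Metric.closedBall q₀ r :=
    Metric.closure_ball_subset_closedBall hq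
  obtain ⟨η, hη, hη0, hη', hbarrier⟩ := hu.exists_add_barrier_le hφ hφ2 hX hdiv hΩ huΩ hle
    Metric.isOpen_ball Metric.isBounded_ball (fun q hq => (hball (hcl hq)).1) hv
    (fun q hq => (hball (hcl hq)).2.1.le) fun q hq hvq => by
      obtain ⟨hqΩ, -, hq'⟩ := hball (hcl (frontier_subset_closure hq))
      refine (hle q hqΩ).lt_of_ne fun huq => ?_
      have hdist := Metric.mem_sphere.1 (Metric.frontier_ball_subset_sphere hq)
      rw [hq' ⟨hqΩ, huq⟩ hvq, dist_self] at hdist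
      exact hr.ne hdist
  have hsum : frameGrad X (fun q => u q + η (v q)) q₀ = 0 :=
    frameGrad_eq_zero_of_isLocalExtr (Or.inr (by
      filter_upwards [Metric.ball_mem_nhds q₀ hr] with q hq
      rw [hv₀, hη0, huq₀, add_zero]
      exact hbarrier q hq))
  have humax : frameGrad X u q₀ = 0 := frameGrad_eq_zero_of_isLocalExtr (Or.inr (by
    filter_upwards [hΩ.mem_nhds hq₀] with q hq using huq₀ ▸ hle q hq))
  have hud := (huΩ.contDiffAt (hΩ.mem_nhds hq₀)).differentiableAt one_ne_zero
  have hηd : DifferentiableAt ℝ η (v q₀) := hη.differentiable two_ne_zero _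
  have hvd : DifferentiableAt ℝ v q₀ := hv.differentiable two_ne_zero q₀
  have hηvd : DifferentiableAt ℝ (fun q => η (v q)) q₀ := hηd.comp q₀ hvd
  rw [frameGrad_add hud hηvd, humax, zero_add, frameGrad_comp hηd hvd] at hsum
  have hv₀' := (smul_eq_zero.1 hsum).resolve_left (hη' _).ne'
  norm_num [hv₀'] at hnorm

end BoundaryPoint

section Propagation

theorem exists_isLocalMaxOn_sub_mul {E : Type*} [MetricSpace E] [ProperSpace E] {F : Set E}
    (hF : IsClosed F) {f g : E → ℝ} (hf : Continuous f) (hg : Continuous g) (hg0 : ∀ q, 0 ≤ g q)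
    {p : E} (hp : p ∈ F) (hgp : g p = 0) {r : ℝ} (hr : 0 < r)
    (hpos : ∀ q ∈ F ∩ Metric.sphere p r, f p ≤ f q → 0 < g q) :
    ∃ C : ℝ, ∃ q ∈ F ∩ Metric.ball p r, IsLocalMaxOn (fun q => f q - C * g q) F q := by
  have hsphere : IsCompact (F ∩ Metric.sphere p r ∩ f ⁻¹' Ici (f p)) :=
    ((isCompact_sphere p r).inter_left hF).inter_right (isClosed_Ici.preimage hf)
  obtain ⟨ε, hε, hεg⟩ := hsphere.exists_forall_le' hg.continuousOn fun q hq => hpos q hq.1 hq.2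
  obtain ⟨B, hB⟩ := (isCompact_closedBall p r).exists_bound_of_continuousOn
    (hf.sub continuous_const : Continuous fun q => f q - f p).continuousOn
  have hpB : p ∈ Metric.closedBall p r := Metric.mem_closedBall_self hr.le
  have hB0 : 0 ≤ B := (norm_nonneg _).trans (hB p hpB)
  set C := (B + 1) / ε
  obtain ⟨q, ⟨hqF, hqr⟩, hqmax⟩ := ((isCompact_closedBall p r).inter_left hF).exists_isMaxOn
    ⟨p, hp, hpB⟩ (hf.sub (continuous_const.mul hg) : Continuous fun q => f q - C * g q).continuousOn
  have hpq : f p ≤ f q - C * g q := by simpa [hgp] using hqmax ⟨hp, hpB⟩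
  have hqball : q ∈ Metric.ball p r := by
    refine (Metric.mem_closedBall.1 hqr).lt_of_ne fun hqs => ?_
    have hgε : ε ≤ g q :=
      hεg q ⟨⟨hqF, hqs⟩, hpq.trans (sub_le_self _ (mul_nonneg (by positivity) (hg0 q)))⟩
    have hCg : B + 1 ≤ C * g q := by
      rw [← div_mul_cancel₀ (B + 1) hε.ne']
      gcongr
    have hBq : f q - f p ≤ B := (le_abs_self _).trans (hB q hqr)
    linarith
  refine ⟨C, q, ⟨hqF, hqball⟩, ?_⟩
  filter_upwards [self_mem_nhdsWithin,
    mem_nhdsWithin_of_mem_nhds (Metric.isOpen_ball.mem_nhds hqball)] with q' hq'F hq'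
  exact hqmax ⟨hq'F, Metric.ball_subset_closedBall hq'⟩

variable {E : Type*} [NormedAddCommGroup E] [NormedSpace ℝ E]

theorem fderiv_apply_eq_one_of_forall_add_smul {w : E → ℝ} {q v : E}
    (hw : DifferentiableAt ℝ w q) (h : ∀ s : ℝ, w (q + s • v) = w q + s) :
    fderiv ℝ w q v = 1 := by
  have hline : HasDerivAt (fun s : ℝ => w (q + s • v)) (fderiv ℝ w q v) 0 :=
    hw.hasFDerivAt.hasLineDerivAt v
  simp only [h] at hline
  exact hline.unique ((hasDerivAt_id (0 : ℝ)).const_add (w q))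

/-- The integral curves of the vector field `Z` are straight lines, and `σ` is a global time
function along them. -/
structure IsStraightFlow (Z : E → E) (σ : E → ℝ) : Prop where
  contDiff_field : ContDiff ℝ 2 Z
  contDiff_time : ContDiff ℝ 2 σ
  field_add_smul : ∀ (q : E) (s : ℝ), Z (q + s • Z q) = Z q
  time_add_smul : ∀ (q : E) (s : ℝ), σ (q + s • Z q) = σ q + s

/-- The point where the integral curve of `Z` through `q` meets `{σ = 0}`. -/
def flowFoot (Z : E → E) (σ : E → ℝ) (q : E) : E := q - σ q • Z q

variable {Z : E → E} {σ : E → ℝ} {p q : E}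

theorem IsStraightFlow.flowFoot_add_smul (h : IsStraightFlow Z σ) (q : E) (s : ℝ) :
    flowFoot Z σ (q + s • Z q) = flowFoot Z σ q := by
  rw [flowFoot, h.field_add_smul, h.time_add_smul, flowFoot]
  module

theorem IsStraightFlow.field_flowFoot (h : IsStraightFlow Z σ) (q : E) :
    Z (flowFoot Z σ q) = Z q := by
  rw [flowFoot, sub_eq_add_neg, ← neg_smul, h.field_add_smul]

theorem IsStraightFlow.eq_add_smul_of_flowFoot_eq (h : IsStraightFlow Z σ)
    (hpq : flowFoot Z σ q = flowFoot Z σ p) : q = p + (σ q - σ p) • Z p := by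
  have hZ : Z q = Z p := by rw [← h.field_flowFoot, hpq, h.field_flowFoot]
  rw [flowFoot, flowFoot, hZ, sub_eq_sub_iff_add_eq_add] at hpq
  rw [sub_smul, ← add_sub_assoc, ← hpq, add_sub_cancel_right]

variable [FiniteDimensional ℝ E] {Ω F : Set E}

theorem IsStraightFlow.exists_add_smul_mem (h : IsStraightFlow Z σ) (hF : IsClosed F)
    (hΩ : IsOpen Ω) (hpF : p ∈ F) (hpΩ : p ∈ Ω)
    (htan : ∀ q ∈ F ∩ Ω, ∀ w : E → ℝ, ContDiff ℝ 2 w → IsLocalMaxOn w F q →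
      fderiv ℝ w q (Z q) = 0) {τ : ℝ} (hτ : 0 < τ) : ∃ s ∈ Ioc 0 τ, p + s • Z p ∈ F := by
  by_contra! hexit
  have : ProperSpace E := FiniteDimensional.proper_real E
  set g : E → ℝ := fun q => ‖toEuclidean (flowFoot Z σ q - flowFoot Z σ p)‖ ^ 2 with hg
  have hgs : ContDiff ℝ 2 g := (toEuclidean.contDiff.comp
    ((contDiff_id.sub (h.contDiff_time.smul h.contDiff_field)).sub contDiff_const)).norm_sq ℝ
  obtain ⟨r, hr, hball⟩ := Metric.nhds_basis_closedBall.eventually_iff.1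
    ((hΩ.eventually_mem hpΩ).and (h.contDiff_time.continuous.continuousAt.eventually
      (gt_mem_nhds (lt_add_of_pos_right (σ p) hτ))))
  obtain ⟨C, q, ⟨hqF, hqr⟩, hmax⟩ := exists_isLocalMaxOn_sub_mul hF h.contDiff_time.continuous
    hgs.continuous (fun q => sq_nonneg _) hpF (by simp [hg]) hr fun q ⟨hqF, hqr⟩ hσ => by
      by_contra! hgq
      have hfoot : flowFoot Z σ q = flowFoot Z σ p := by
        simpa [hg, sub_eq_zero] using hgq
      have hq := h.eq_add_smul_of_flowFoot_eq hfoot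
      rcases hσ.eq_or_lt with hσ | hσ
      · rw [hσ, sub_self, zero_smul, add_zero] at hq
        exact Metric.ne_of_mem_sphere hqr hr.ne' hq
      · have hστ : σ q < σ p + τ := (hball (Metric.sphere_subset_closedBall hqr)).2
        exact hexit _ ⟨sub_pos.2 hσ, by linarith⟩ (hq ▸ hqF)
  have hws : ContDiff ℝ 2 fun q => σ q - C * g q :=
    h.contDiff_time.sub (contDiff_const.mul hgs)
  have hone := fderiv_apply_eq_one_of_forall_add_smul (hws.differentiable two_ne_zero q)
    (v := Z q) fun s => by simp only [hg, h.flowFoot_add_smul, h.time_add_smul]; ring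
  exact zero_ne_one ((htan q ⟨hqF, (hball (Metric.ball_subset_closedBall hqr)).1⟩ _ hws
    hmax).symm.trans hone)

theorem IsStraightFlow.add_mem_of_tangent (h : IsStraightFlow Z σ) (hF : IsClosed F)
    (hΩ : IsOpen Ω) (hpF : p ∈ F)
    (htan : ∀ q ∈ F ∩ Ω, ∀ w : E → ℝ, ContDiff ℝ 2 w → IsLocalMaxOn w F q →
      fderiv ℝ w q (Z q) = 0)
    (hseg : ∀ s ∈ Icc (0 : ℝ) 1, p + s • Z p ∈ Ω) : p + Z p ∈ F := by
  have hcont : Continuous fun s : ℝ => p + s • Z p := by fun_prop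
  have hsub : Icc (0 : ℝ) 1 ⊆ (fun s : ℝ => p + s • Z p) ⁻¹' F := by
    refine IsClosed.Icc_subset_of_forall_exists_gt ((hF.preimage hcont).inter isClosed_Icc)
      (by simpa using hpF) fun s ⟨hsF, hs⟩ t hst => ?_
    obtain ⟨τ, hτ, hτF⟩ := h.exists_add_smul_mem hF hΩ hsF (hseg s (Ico_subset_Icc_self hs)) htan
      (sub_pos.2 hst)
    rw [h.field_add_smul, add_assoc, ← add_smul] at hτF
    exact ⟨s + τ, hτF, by linarith [hτ.1], by linarith [hτ.2]⟩
  simpa using hsub (right_mem_Icc.2 zero_le_one)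

end Propagation

section AffineField

variable {E : Type*} [NormedAddCommGroup E] [NormedSpace ℝ E] [FiniteDimensional ℝ E]
  [MeasurableSpace E] [BorelSpace E] {μ : Measure E} [μ.IsAddHaarMeasure]

theorem integral_clm_add_const_mul_fderiv_eq_zero {g : E → ℝ} (hg : ContDiff ℝ 1 g)
    (hgc : HasCompactSupport g) {ℓ : E →L[ℝ] ℝ} {c : ℝ} {v : E} (hℓ : ℓ v = 0) :
    ∫ q, (ℓ q + c) * fderiv ℝ g q v ∂μ = 0 := by
  have : Continuous g := hg.continuous
  have : Continuous fun q => fderiv ℝ g q v :=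
    (hg.continuous_fderiv one_ne_zero).clm_apply continuous_const
  rw [integral_mul_fderiv_eq_neg_fderiv_mul_of_integrable]
  · simp [hℓ]
  · simp [hℓ]
  · exact Continuous.integrable_of_hasCompactSupport (by fun_prop) (hgc.fderiv_apply ℝ v).mul_left
  · exact Continuous.integrable_of_hasCompactSupport (by fun_prop) hgc.mul_left
  · intro q _
    fun_prop
  · intro q _
    exact hg.differentiable one_ne_zero q

theorem integral_fderiv_const_add_clm_smul_eq_zero {g : E → ℝ} (hg : ContDiff ℝ 1 g)
    (hgc : HasCompactSupport g) (v : E) {ℓ : E →L[ℝ] ℝ} {e : E} (hℓ : ℓ e = 0) :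
    ∫ q, fderiv ℝ g q (v + ℓ q • e) ∂μ = 0 := by
  have hderiv (w : E) : Continuous fun q => fderiv ℝ g q w :=
    (hg.continuous_fderiv one_ne_zero).clm_apply continuous_const
  have hconst : ∫ q, fderiv ℝ g q v ∂μ = 0 := by
    simpa using integral_clm_add_const_mul_fderiv_eq_zero (μ := μ) hg hgc (ℓ := 0) (c := 1)
      (v := v) rfl
  have hlin : ∫ q, ℓ q * fderiv ℝ g q e ∂μ = 0 := by
    simpa using integral_clm_add_const_mul_fderiv_eq_zero (μ := μ) hg hgc (c := 0) hℓ
  simp only [map_add, map_smul, smul_eq_mul]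
  rw [integral_add, hconst, hlin, add_zero]
  · exact (hderiv v).integrable_of_hasCompactSupport (hgc.fderiv_apply ℝ v)
  · exact (ℓ.continuous.mul (hderiv e)).integrable_of_hasCompactSupport
      (hgc.fderiv_apply ℝ e).mul_left

end AffineField

section HeisenbergFrame

variable {m : ℕ}

instance isAddHaarMeasure_volume_heis : (volume : Measure (Heis m)).IsAddHaarMeasure :=
  have : ((volume : Measure (Fin m → ℝ)).prod (volume : Measure ℝ)).IsAddHaarMeasure :=
    Measure.prod.instIsAddHaarMeasure _ _
  Measure.prod.instIsAddHaarMeasure (volume : Measure (Fin m → ℝ))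
    ((volume : Measure (Fin m → ℝ)).prod (volume : Measure ℝ))

/-- The horizontal frame `X_1, …, X_m, Y_1, …, Y_m`. -/
def heisFrame (i : Fin m ⊕ Fin m) (q : Heis m) : Heis m :=
  Sum.elim (fun j => heisX j q) (fun j => heisY j q) i

theorem contDiff_heisFrame {n : WithTop ℕ∞} (i : Fin m ⊕ Fin m) :
    ContDiff ℝ n (heisFrame i : Heis m → Heis m) := by
  rcases i with j | j
  · change ContDiff ℝ n fun q : Heis m => heisX j q
    unfold heisX
    fun_prop
  · change ContDiff ℝ n fun q : Heis m => heisY j q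
    unfold heisY
    fun_prop

theorem isDivergenceFree_heisFrame :
    IsDivergenceFree (heisFrame : Fin m ⊕ Fin m → Heis m → Heis m) volume := by
  rintro (j | j) g hg hgc
  · let ℓ : Heis m →L[ℝ] ℝ := (2 : ℝ) • ((ContinuousLinearMap.proj j).comp
      ((ContinuousLinearMap.fst ℝ (Fin m → ℝ) ℝ).comp
        (ContinuousLinearMap.snd ℝ (Fin m → ℝ) ((Fin m → ℝ) × ℝ))))
    have hX (q : Heis m) : heisFrame (Sum.inl j) q = (Pi.single j 1, 0, 0) + ℓ q • (0, 0, 1) := by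
      simp [heisFrame, heisX, ℓ]
    simpa only [hX] using
      integral_fderiv_const_add_clm_smul_eq_zero hg hgc _ (by simp [ℓ] : ℓ (0, 0, 1) = 0)
  · let ℓ : Heis m →L[ℝ] ℝ := (-2 : ℝ) • ((ContinuousLinearMap.proj j).comp
      (ContinuousLinearMap.fst ℝ (Fin m → ℝ) ((Fin m → ℝ) × ℝ)))
    have hY (q : Heis m) : heisFrame (Sum.inr j) q = (0, Pi.single j 1, 0) + ℓ q • (0, 0, 1) := by
      simp [heisFrame, heisY, ℓ]
    simpa only [hY] using
      integral_fderiv_const_add_clm_smul_eq_zero hg hgc _ (by simp [ℓ] : ℓ (0, 0, 1) = 0)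

theorem heisGrad_eq_frameGrad (u : Heis m → ℝ) : heisGrad u = frameGrad heisFrame u := by
  ext q i
  rcases i with j | j <;> rfl

theorem PhiLaplacianNonneg.isWeakSubsolution {φ : ℝ → ℝ} {Ω : Set (Heis m)} {u : Heis m → ℝ}
    (hu : PhiLaplacianNonneg φ Ω u) :
    IsWeakSubsolution heisFrame (radialFlux φ) volume Ω u := fun ζ hζ hζc hζΩ hζ0 => by
  simpa only [heisFlux, heisGrad_eq_frameGrad, radialFlux, Left.nonneg_neg_iff] using
    hu ζ hζ hζc hζΩ hζ0

theorem frameVector_heisFrame (a : EuclideanSpace ℝ (Fin m ⊕ Fin m)) (q : Heis m) :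
    frameVector heisFrame a q = (fun j => a (Sum.inl j), fun j => a (Sum.inr j),
      2 * ∑ j, (q.2.1 j * a (Sum.inl j) - q.1 j * a (Sum.inr j))) := by
  refine Prod.ext (funext fun k => ?_) (Prod.ext (funext fun k => ?_) ?_)
  · simp [frameVector, heisFrame, heisX, heisY, Prod.fst_sum, Pi.single_apply]
  · simp [frameVector, heisFrame, heisX, heisY, Prod.fst_sum, Prod.snd_sum, Pi.single_apply]
  · simp only [frameVector, heisFrame, heisX, heisY, Prod.snd_sum, Fintype.sum_sum_type,
      Sum.elim_inl, Sum.elim_inr, Prod.snd_add, Prod.smul_snd, smul_eq_mul, Finset.mul_sum,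
      ← Finset.sum_add_distrib]
    exact Finset.sum_congr rfl fun j _ => by ring

theorem add_frameVector_heisFrame (x y : Fin m → ℝ) (q : Heis m) :
    q + frameVector heisFrame (WithLp.toLp 2 (Sum.elim x y)) q = heisMul q (x, y, 0) := by
  rw [frameVector_heisFrame]
  refine Prod.ext rfl (Prod.ext rfl ?_)
  simp [heisMul]

theorem frameVector_heisFrame_add_smul (a : EuclideanSpace ℝ (Fin m ⊕ Fin m)) (q : Heis m)
    (s : ℝ) : frameVector heisFrame a (q + s • frameVector heisFrame a q) =
      frameVector heisFrame a q := by
  simp only [frameVector_heisFrame]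
  congr! 4 with j
  simp
  ring

theorem isStraightFlow_frameVector_heisFrame {a : EuclideanSpace ℝ (Fin m ⊕ Fin m)}
    (ha : a ≠ 0) : IsStraightFlow (frameVector heisFrame a) fun q : Heis m =>
      (∑ j, a (Sum.inl j) * q.1 j + ∑ j, a (Sum.inr j) * q.2.1 j) / ‖a‖ ^ 2 where
  contDiff_field := ContDiff.sum fun i _ => (contDiff_heisFrame i).const_smul (a i)
  contDiff_time := by fun_prop
  field_add_smul := frameVector_heisFrame_add_smul a
  time_add_smul q s := by
    have ha2 : ‖a‖ ^ 2 ≠ 0 := pow_ne_zero _ (norm_ne_zero_iff.2 ha)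
    rw [div_add' _ _ _ ha2, EuclideanSpace.real_norm_sq_eq, Fintype.sum_sum_type]
    congr 1
    simp only [Finset.mul_sum, mul_add, ← Finset.sum_add_distrib]
    refine Finset.sum_congr rfl fun j _ => ?_
    simp only [frameVector_heisFrame, Prod.fst_add, Prod.snd_add, Prod.smul_fst, Prod.smul_snd,
      Pi.add_apply, Pi.smul_apply, smul_eq_mul]
    ring

theorem heisMul_mem_of_tangent {Ω F : Set (Heis m)} (hF : IsClosed F) (hΩ : IsOpen Ω)
    (htan : ∀ q ∈ F ∩ Ω, ∀ w : Heis m → ℝ, ContDiff ℝ 2 w → IsLocalMaxOn w F q →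
      frameGrad heisFrame w q = 0) {B : Set (Heis m)} (hB : Convex ℝ B) (hBΩ : B ⊆ Ω)
    {p : Heis m} (hpF : p ∈ F) (hpB : p ∈ B) {x y : Fin m → ℝ} (hend : heisMul p (x, y, 0) ∈ B) :
    heisMul p (x, y, 0) ∈ F := by
  rw [← add_frameVector_heisFrame] at hend ⊢
  set a := WithLp.toLp 2 (Sum.elim x y)
  rcases eq_or_ne a 0 with ha | ha
  · simpa [ha, frameVector] using hpF
  · refine (isStraightFlow_frameVector_heisFrame ha).add_mem_of_tangent hF hΩ hpF
      (fun q hq w hw hmax => ?_) fun s hs => hBΩ (hB.add_smul_mem hpB hend hs)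
    rw [← inner_frameGrad, htan q hq w hw hmax, inner_zero_right]

end HeisenbergFrame

section Reachability

variable {m : ℕ}

theorem continuous_heisMul : Continuous fun p : Heis m × Heis m => heisMul p.1 p.2 := by
  unfold heisMul
  fun_prop

theorem heisMul_commutator (q : Heis m) (x y : Fin m → ℝ) :
    heisMul (heisMul (heisMul (heisMul q (x, 0, 0)) (0, y, 0)) (-x, 0, 0)) (0, -y, 0) =
      q + (0, 0, -4 * ∑ i, x i * y i) := by
  refine Prod.ext ?_ (Prod.ext ?_ ?_)
  · simp [heisMul]
  · simp [heisMul]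
  · simp only [heisMul, Prod.snd_add, Finset.mul_sum, add_assoc]
    congr 1
    simp only [add_zero, zero_add, ← Finset.sum_add_distrib]
    refine Finset.sum_congr rfl fun i _ => ?_
    simp only [Pi.add_apply, Pi.neg_apply, Pi.zero_apply]
    ring

theorem exists_continuous_mul_eq_self :
    ∃ α β : ℝ → ℝ, Continuous α ∧ Continuous β ∧ α 0 = 0 ∧ β 0 = 0 ∧ ∀ t, α t * β t = t := by
  refine ⟨fun t => √t + √(-t), fun t => √t - √(-t), by fun_prop, by fun_prop, by simp, by simp,
    fun t => ?_⟩
  rw [← sq_sub_sq]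
  rcases le_total 0 t with ht | ht
  · simp [Real.sq_sqrt ht, Real.sqrt_eq_zero_of_nonpos (neg_nonpos.2 ht)]
  · simp [Real.sq_sqrt (neg_nonneg.2 ht), Real.sqrt_eq_zero_of_nonpos ht]

theorem tendsto_heisMul_horizontal {F U : Set (Heis m)} {q₀ : Heis m} (hU : U ∈ 𝓝 q₀)
    (hinv : ∀ p ∈ F ∩ U, ∀ x y, heisMul p (x, y, 0) ∈ U → heisMul p (x, y, 0) ∈ F)
    {α : Type*} {l : Filter α} {g : α → Heis m} (hg : Tendsto g l (𝓝[F] q₀))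
    {x y : α → Fin m → ℝ} (hx : Tendsto x l (𝓝 0)) (hy : Tendsto y l (𝓝 0)) :
    Tendsto (fun a => heisMul (g a) (x a, y a, 0)) l (𝓝[F] q₀) := by
  have hgq := tendsto_nhds_of_tendsto_nhdsWithin hg
  have hlim : Tendsto (fun a => heisMul (g a) (x a, y a, 0)) l (𝓝 q₀) := by
    have hone : heisMul q₀ (0, 0, 0) = q₀ := by simp [heisMul]
    have h := (continuous_heisMul.tendsto (q₀, (0, 0, 0))).comp
      (hgq.prodMk_nhds (hx.prodMk_nhds (hy.prodMk_nhds (tendsto_const_nhds (x := (0 : ℝ))))))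
    rwa [hone] at h
  refine tendsto_nhdsWithin_iff.2 ⟨hlim, ?_⟩
  filter_upwards [(tendsto_nhdsWithin_iff.1 hg).2, hgq hU, hlim hU] with a haF haU hend
  exact hinv _ ⟨haF, haU⟩ _ _ hend

theorem tendsto_add_vertical (hm : 1 ≤ m) {F U : Set (Heis m)} {q₀ : Heis m} (hU : U ∈ 𝓝 q₀)
    (hinv : ∀ p ∈ F ∩ U, ∀ x y, heisMul p (x, y, 0) ∈ U → heisMul p (x, y, 0) ∈ F)
    {γ : Type*} {l : Filter γ} {g : γ → Heis m} (hg : Tendsto g l (𝓝[F] q₀))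
    {t : γ → ℝ} (ht : Tendsto t l (𝓝 0)) :
    Tendsto (fun c => g c + (0, 0, t c)) l (𝓝[F] q₀) := by
  obtain ⟨α, β, hα, hβ, hα0, hβ0, hαβ⟩ := exists_continuous_mul_eq_self
  let j : Fin m := ⟨0, hm⟩
  let x : ℝ → Fin m → ℝ := fun s => Pi.single j (α (-s / 4))
  let y : ℝ → Fin m → ℝ := fun s => Pi.single j (β (-s / 4))
  have hxc : Continuous x := (continuous_single j).comp (hα.comp (by fun_prop))
  have hyc : Continuous y := (continuous_single j).comp (hβ.comp (by fun_prop))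
  have hx : Tendsto (fun c => x (t c)) l (𝓝 0) := (hxc.tendsto' 0 0 (by simp [x, hα0])).comp ht
  have hy : Tendsto (fun c => y (t c)) l (𝓝 0) := (hyc.tendsto' 0 0 (by simp [y, hβ0])).comp ht
  have hloop := tendsto_heisMul_horizontal hU hinv
    (tendsto_heisMul_horizontal hU hinv
      (tendsto_heisMul_horizontal hU hinv
        (tendsto_heisMul_horizontal hU hinv hg hx tendsto_const_nhds)
        tendsto_const_nhds hy)
      (by simpa using hx.neg) tendsto_const_nhds)
    tendsto_const_nhds (by simpa using hy.neg)
  have hsum (s : ℝ) : -4 * ∑ i, x s i * y s i = s := by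
    simp only [x, y, Pi.single_apply, ite_mul, zero_mul, mul_ite, mul_zero,
      Finset.sum_ite_eq', Finset.mem_univ, if_true, hαβ]
    ring
  simpa only [heisMul_commutator, hsum] using hloop

theorem mem_nhds_of_heisMul_horizontal_mem (hm : 1 ≤ m) {F U : Set (Heis m)} {q₀ : Heis m}
    (hq₀ : q₀ ∈ F) (hU : U ∈ 𝓝 q₀)
    (hinv : ∀ p ∈ F ∩ U, ∀ x y, heisMul p (x, y, 0) ∈ U → heisMul p (x, y, 0) ∈ F) :
    F ∈ 𝓝 q₀ := by
  have hconst : Tendsto (fun _ : Heis m => q₀) (𝓝 q₀) (𝓝[F] q₀) :=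
    tendsto_nhdsWithin_iff.2 ⟨tendsto_const_nhds, Eventually.of_forall fun _ => hq₀⟩
  have hx : Tendsto (fun q : Heis m => q.1 - q₀.1) (𝓝 q₀) (𝓝 0) :=
    Continuous.tendsto' (by fun_prop) _ _ (sub_self _)
  have hy : Tendsto (fun q : Heis m => q.2.1 - q₀.2.1) (𝓝 q₀) (𝓝 0) :=
    Continuous.tendsto' (by fun_prop) _ _ (sub_self _)
  have hg := tendsto_heisMul_horizontal hU hinv hconst hx hy
  have ht : Tendsto (fun q : Heis m => q.2.2 - (heisMul q₀ (q.1 - q₀.1, q.2.1 - q₀.2.1, 0)).2.2)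
      (𝓝 q₀) (𝓝 0) :=
    Continuous.tendsto' (by unfold heisMul; fun_prop) _ _ (by simp [heisMul])
  have hend (q : Heis m) : heisMul q₀ (q.1 - q₀.1, q.2.1 - q₀.2.1, 0) +
      (0, 0, q.2.2 - (heisMul q₀ (q.1 - q₀.1, q.2.1 - q₀.2.1, 0)).2.2) = q :=
    Prod.ext (by simp [heisMul]) (Prod.ext (by simp [heisMul]) (add_sub_cancel _ _))
  have hid := tendsto_add_vertical hm hU hinv hg ht
  simp only [hend] at hid
  exact (tendsto_nhdsWithin_iff.1 hid).2

end Reachability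

theorem mainTheorem9 (m : ℕ) (hm : 1 ≤ m) (φ : ℝ → ℝ) (hφ : PhiStructural φ)
    (hφ2 : PhiRelaxedHomogeneous φ) (Ω : Set (Heis m)) (hΩ_open : IsOpen Ω)
    (hΩ_conn : IsConnected Ω) (u : Heis m → ℝ) (hu_cont : ContinuousOn u (closure Ω))
    (hu_diff : ContDiffOn ℝ 1 u Ω) (hu_sub : PhiLaplacianNonneg φ Ω u)
    (uStar : ℝ) (huStar : IsLUB (u '' Ω) uStar)
    (qM : Heis m) (hqM : qM ∈ Ω) (hmax : u qM = uStar) :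
    ∀ q ∈ closure Ω, u q = uStar := by
  have hle : ∀ q ∈ Ω, u q ≤ uStar := fun q hq => huStar.1 (mem_image_of_mem u hq)
  set F : Set (Heis m) := closure Ω ∩ u ⁻¹' {uStar}
  have hF : IsClosed F :=
    hu_cont.preimage_isClosed_of_isClosed isClosed_closure isClosed_singleton
  have htan (q : Heis m) (hq : q ∈ F ∩ Ω) (w : Heis m → ℝ) (hw : ContDiff ℝ 2 w)
      (hwmax : IsLocalMaxOn w F q) : frameGrad heisFrame w q = 0 :=
    hu_sub.isWeakSubsolution.frameGrad_eq_zero_of_isLocalMaxOn hφ hφ2 contDiff_heisFrame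
      isDivergenceFree_heisFrame hΩ_open hu_diff hle hq.2 hq.1.2 hw
      (hwmax.on_subset (inter_subset_inter_left _ subset_closure))
  have hFΩ : IsOpen (F ∩ Ω) := isOpen_iff_mem_nhds.2 fun q hq => by
    obtain ⟨r, hr, hrΩ⟩ := Metric.isOpen_iff.1 hΩ_open q hq.2
    exact inter_mem (mem_nhds_of_heisMul_horizontal_mem hm hq.1 (Metric.ball_mem_nhds q hr)
      fun p hp x y hend => heisMul_mem_of_tangent hF hΩ_open htan (convex_ball q r) hrΩ hp.1 hp.2
        hend) (hΩ_open.mem_nhds hq.2)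
  have hsub : Ω ⊆ F ∩ Ω := hΩ_conn.isPreconnected.subset_of_closure_inter_subset hFΩ
    ⟨qM, hqM, ⟨subset_closure hqM, hmax⟩, hqM⟩
    fun q hq => ⟨closure_minimal inter_subset_left hF hq.1, hq.2⟩
  exact fun q hq => (closure_minimal (hsub.trans inter_subset_left) hF hq).2
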